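/- Let $\mu$ be the Haar probability measure on $\mathrm{SO}(3)$, let $\mathcal X=L^2(\mathrm{SO}(3),\mathbb C)$ with inner product $\langle x,y\rangle=\int x\,\bar y\,d\mu$, and let $(\ell_A y)(B)=y(A^{-1}B)$ for $A,B\in\mathrm{SO}(3)$. For $x,\psi\in\mathcal X$ define the left covariance (convolution) $x*_\ell\psi:\mathrm{SO}(3)\to\mathbb C$ by $(x*_\ell\psi)(A)=\langle x,\ell_A\psi\rangle$. Let $Z(\theta)$ and $Y(\theta)$ be the rotations by the angle $\theta$ around the $z$-axis and the $y$-axis. For $l=0,1,2,\dots$ the Wigner D-matrix $D^l=(D^l_{m,n})_{-l\le m,n\le l}$ is the function on $\mathrm{SO}(3)$ given in Euler angles by $$D^l_{m,n}\big(Z(\alpha)Y(\beta)Z(\gamma)\big)=e^{-im\alpha}\,d^l_{m,n}(\beta)\,e^{-in\gamma},\qquad d^l(\beta)=\exp\!\Big(\tfrac{\beta}{2}\big(Q^l-(Q^l)^{\top}\big)\Big),\quad 0\le\beta\le\pi,$$ where $Q^l$ has the entries $Q^l_{m,m+1}=\sqrt{(l-m)(l+m+1)}$ and is zero elsewhere.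 Let $I$ be the set of triples $(l,m,n)$ with $l\ge 0$ and $-l\le m,n\le l$. A family $(\hat x^l_{m,n})_{I}$ of complex numbers is the family of Fourier coefficients of $x\in\mathcal X$ if $$x=\sum_{(l,m,n)\in I}\hat x^l_{-m,-n}\,D^l_{m,n}$$ with unconditional convergence in $\mathcal X$. Then every $x\in\mathcal X$ has exactly one family of Fourier coefficients, and for all $x,\psi\in\mathcal X$ with Fourier coefficients $(\hat x^l_{m,n})$ and $(\hat\psi^l_{m,n})$ the function $x*_\ell\psi$ belongs to $\mathcal X$ and has the Fourier coefficients $$\widehat{(x*_\ell\psi)}{}^{\,l}_{m,n}=\frac{1}{2l+1}\sum_{s=-l}^{l}\hat x^l_{m,s}\,\overline{\hat\psi^l_{n,s}},\qquad (l,m,n)\in I.$$ -/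

import Mathlib

open MeasureTheory

noncomputable section

namespace SO3Fourier

/-- The group `SO(3)` of real orthogonal `3 × 3` matrices of determinant one. -/
abbrev SO3 : Type := ↥(Matrix.specialOrthogonalGroup (Fin 3) ℝ)

theorem transpose_mul_self (A : SO3) : (A : Matrix (Fin 3) (Fin 3) ℝ).transpose * A.1 = 1 :=
  (Matrix.mem_orthogonalGroup_iff' (Fin 3) ℝ).1 A.2.1

theorem mul_transpose_self (A : SO3) : (A : Matrix (Fin 3) (Fin 3) ℝ) * A.1.transpose = 1 :=
  (Matrix.mem_orthogonalGroup_iff (Fin 3) ℝ).1 A.2.1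

theorem det_eq_one (A : SO3) : (A : Matrix (Fin 3) (Fin 3) ℝ).det = 1 := A.2.2

theorem coe_inv (A : SO3) : ((A⁻¹ : SO3) : Matrix (Fin 3) (Fin 3) ℝ) = A.1.transpose := rfl

instance : IsTopologicalGroup SO3 where
  continuous_mul := by
    refine Continuous.subtype_mk ?_ _
    exact (continuous_subtype_val.comp continuous_fst).matrix_mul
      (continuous_subtype_val.comp continuous_snd)
  continuous_inv := by
    refine continuous_induced_rng.2 ?_
    exact continuous_subtype_val.matrix_transpose

theorem abs_entry_le_one (A : SO3) (i j : Fin 3) : |A.1 i j| ≤ 1 := by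
  have h := congrFun (congrFun (mul_transpose_self A) i) i
  simp only [Matrix.mul_apply, Matrix.transpose_apply, Fin.sum_univ_three, Matrix.one_apply_eq] at h
  rw [abs_le_one_iff_mul_self_le_one]
  fin_cases j <;> simp <;>
    nlinarith [mul_self_nonneg (A.1 i 0), mul_self_nonneg (A.1 i 1), mul_self_nonneg (A.1 i 2)]

instance : CompactSpace SO3 := by
  have hK : IsCompact (Set.pi Set.univ (fun _ : Fin 3 => Set.pi Set.univ
      (fun _ : Fin 3 => Set.Icc (-1 : ℝ) 1))) :=
    isCompact_univ_pi fun _ => isCompact_univ_pi fun _ => isCompact_Icc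
  have hc : IsClosed {A : Matrix (Fin 3) (Fin 3) ℝ | A * A.transpose = 1 ∧ A.det = 1} :=
    (isClosed_eq (continuous_id.matrix_mul continuous_id.matrix_transpose) continuous_const).inter
      (isClosed_eq continuous_id.matrix_det continuous_const)
  have he : ((Matrix.specialOrthogonalGroup (Fin 3) ℝ : Submonoid (Matrix (Fin 3) (Fin 3) ℝ)) :
      Set (Matrix (Fin 3) (Fin 3) ℝ)) = {A | A * A.transpose = 1 ∧ A.det = 1} := by
    ext A
    exact Matrix.mem_specialOrthogonalGroup_iff.trans
      (and_congr (Matrix.mem_orthogonalGroup_iff (Fin 3) ℝ) Iff.rfl)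
  refine isCompact_iff_compactSpace.1 (hK.of_isClosed_subset (he ▸ hc) ?_)
  intro A hA i _ j _
  exact abs_le.1 (abs_entry_le_one ⟨A, hA⟩ i j)

instance : SecondCountableTopology SO3 :=
  inferInstanceAs (SecondCountableTopology
    {A : Fin 3 → Fin 3 → ℝ // A ∈ Matrix.specialOrthogonalGroup (Fin 3) ℝ})

instance : MeasurableSpace SO3 := borel SO3

instance : BorelSpace SO3 := ⟨rfl⟩

/-- The Haar measure of `SO(3)` of total mass one. -/
def haar : Measure SO3 := Measure.haarMeasure ⊤

instance : Measure.IsHaarMeasure haar := Measure.isHaarMeasure_haarMeasure _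

instance : IsProbabilityMeasure haar := ⟨Measure.haarMeasure_self⟩

/-- The space `L²(SO(3), ℂ)`. -/
abbrev L2SO3 : Type := Lp ℂ 2 haar

/-- The left action `(ℓ_A y)(B) = y(A⁻¹ B)` on `L²(SO(3), ℂ)`. -/
def leftAction (A : SO3) (y : L2SO3) : L2SO3 :=
  Lp.compMeasurePreserving (fun B : SO3 => A⁻¹ * B) (measurePreserving_mul_left haar A⁻¹) y

/-- The left covariance `(x *_ℓ ψ)(A) = ⟨x, ℓ_A ψ⟩ = ∫ x(B) conj (ψ(A⁻¹ B)) dμ(B)`. The inner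
product of Mathlib is conjugate-linear in its first argument. -/
def leftCovariance (x ψ : L2SO3) (A : SO3) : ℂ := inner ℂ (leftAction A ψ) x

/-- The rotation by the angle `θ` around the `z`-axis. -/
def rotZ (θ : ℝ) : Matrix (Fin 3) (Fin 3) ℝ :=
  !![Real.cos θ, -Real.sin θ, 0; Real.sin θ, Real.cos θ, 0; 0, 0, 1]

/-- The rotation by the angle `θ` around the `y`-axis. -/
def rotY (θ : ℝ) : Matrix (Fin 3) (Fin 3) ℝ :=
  !![Real.cos θ, 0, Real.sin θ; 0, 1, 0; -Real.sin θ, 0, Real.cos θ]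

/-- Euler angle `α` in `A = Z(α) Y(β) Z(γ)`; it is `0` if `β` is `0` or `π`. -/
def eulerAlpha (A : SO3) : ℝ := Complex.arg ⟨A.1 0 2, A.1 1 2⟩

/-- Euler angle `β ∈ [0, π]` in `A = Z(α) Y(β) Z(γ)`. -/
def eulerBeta (A : SO3) : ℝ := Real.arccos (A.1 2 2)

/-- Euler angle `γ` in `A = Z(α) Y(β) Z(γ)`. -/
def eulerGamma (A : SO3) : ℝ :=
  if A.1 2 2 ^ 2 = 1 then Complex.arg ⟨A.1 1 1, A.1 1 0⟩ else Complex.arg ⟨-A.1 2 0, A.1 2 1⟩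

/-- The index set `{-l, …, l}` of the rows and columns of `D^l`. -/
abbrev Idx (l : ℕ) : Type := {m : ℤ // m ∈ Finset.Icc (-(l : ℤ)) l}

instance (l : ℕ) : Neg (Idx l) :=
  ⟨fun m => ⟨-m.1, by have := Finset.mem_Icc.1 m.2; exact Finset.mem_Icc.2 (by omega)⟩⟩

/-- The matrix `Q^l` with entries `√((l - m)(l + m + 1))` at `(m, m + 1)` and `0` elsewhere. -/
def ladder (l : ℕ) : Matrix (Idx l) (Idx l) ℝ :=
  Matrix.of fun m n => if m.1 + 1 = n.1 then √(((l : ℝ) - m.1) * ((l : ℝ) + m.1 + 1)) else 0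

/-- The real orthogonal matrix `d^l(β) = exp((β / 2) (Q^l - (Q^l)ᵀ))`, with the matrix
exponential. -/
def wignerSmallD (l : ℕ) (β : ℝ) : Matrix (Idx l) (Idx l) ℝ :=
  NormedSpace.exp ((β / 2) • (ladder l - (ladder l).transpose))

/-- The Wigner D-matrix `D^l(Z(α) Y(β) Z(γ)) = exp(-iαΛ) d^l(β) exp(-iγΛ)`, where `Λ` is the
diagonal matrix with entries `-l, …, l`. -/
def wignerD (l : ℕ) (A : SO3) : Matrix (Idx l) (Idx l) ℂ :=
  Matrix.of fun m n =>
    Complex.exp (-Complex.I * m.1 * eulerAlpha A) * (wignerSmallD l (eulerBeta A) m n : ℂ) *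
      Complex.exp (-Complex.I * n.1 * eulerGamma A)

theorem cos_sin_arg {a b r : ℝ} (hr : 0 < r) (h : a ^ 2 + b ^ 2 = r ^ 2) :
    Real.cos (Complex.arg ⟨a, b⟩) = a / r ∧ Real.sin (Complex.arg ⟨a, b⟩) = b / r := by
  have hn : ‖(⟨a, b⟩ : ℂ)‖ = r := by
    rw [Complex.norm_def, Complex.normSq_mk, ← Real.sqrt_sq hr.le, ← h]
    ring_nf
  have h0 : (⟨a, b⟩ : ℂ) ≠ 0 := by
    rw [← norm_pos_iff, hn]; exact hr
  exact ⟨by rw [Complex.cos_arg h0, hn], by rw [Complex.sin_arg, hn]⟩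

/-- The angles chosen above are Euler angles of `A`. -/
theorem euler_decomposition (A : SO3) :
    (A : Matrix (Fin 3) (Fin 3) ℝ) =
      rotZ (eulerAlpha A) * rotY (eulerBeta A) * rotZ (eulerGamma A) := by
  have hadj : (A.1).adjugate = A.1.transpose := by
    have h := congrArg (· * A.1.transpose) (Matrix.adjugate_mul A.1)
    simpa [Matrix.mul_assoc, mul_transpose_self, det_eq_one] using h
  have hr := congrFun (congrFun (mul_transpose_self A) 2) 2
  have hc := congrFun (congrFun (transpose_mul_self A) 2) 2
  have hr1 := congrFun (congrFun (mul_transpose_self A) 1) 1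
  have hb : |A.1 2 2| ≤ 1 := abs_entry_le_one A 2 2
  have hcos : Real.cos (eulerBeta A) = A.1 2 2 :=
    Real.cos_arccos (abs_le.1 hb).1 (abs_le.1 hb).2
  have hsin : Real.sin (eulerBeta A) = √(1 - A.1 2 2 ^ 2) := Real.sin_arccos _
  have a00 := congrFun (congrFun hadj 0) 0
  have a01 := congrFun (congrFun hadj 1) 0
  have a10 := congrFun (congrFun hadj 0) 1
  have a11 := congrFun (congrFun hadj 1) 1
  simp only [Matrix.mul_apply, Matrix.transpose_apply, Fin.sum_univ_three,
    Matrix.one_apply_eq] at hr hc hr1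
  simp [Matrix.adjugate_fin_three] at a00 a01 a10 a11
  have main : ∀ ca sa cg sg sb : ℝ,
      A.1 0 0 = ca * A.1 2 2 * cg - sa * sg → A.1 0 1 = -(ca * A.1 2 2 * sg) - sa * cg →
      A.1 0 2 = ca * sb → A.1 1 0 = sa * A.1 2 2 * cg + ca * sg →
      A.1 1 1 = -(sa * A.1 2 2 * sg) + ca * cg → A.1 1 2 = sa * sb →
      A.1 2 0 = -(sb * cg) → A.1 2 1 = sb * sg →
      A.1 = !![ca, -sa, 0; sa, ca, 0; 0, 0, 1] * !![A.1 2 2, 0, sb; 0, 1, 0; -sb, 0, A.1 2 2] *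
        !![cg, -sg, 0; sg, cg, 0; 0, 0, 1] := by
    intros
    ext i j
    fin_cases i <;> fin_cases j <;> simp [Matrix.mul_apply, Fin.sum_univ_three] <;> linarith
  rw [rotZ, rotZ, rotY, hcos]
  by_cases hd : A.1 2 2 ^ 2 = 1
  · have hs : Real.sin (eulerBeta A) = 0 := by rw [hsin, hd]; simp
    obtain ⟨h02, h12⟩ : A.1 0 2 = 0 ∧ A.1 1 2 = 0 :=
      mul_self_add_mul_self_eq_zero.1 (by linarith only [hc, hd])
    obtain ⟨h20, h21⟩ : A.1 2 0 = 0 ∧ A.1 2 1 = 0 :=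
      mul_self_add_mul_self_eq_zero.1 (by linarith only [hr, hd])
    obtain ⟨k1, k2⟩ := cos_sin_arg (a := A.1 1 1) (b := A.1 1 0) one_pos
      (by rw [h12] at hr1; linarith)
    have e0 : eulerAlpha A = 0 := by
      rw [eulerAlpha, h02, h12]; exact Complex.arg_zero
    simp only [h12, h20, h21, h02] at a00 a01 a10 a11
    rw [eulerGamma, if_pos hd, e0, k1, k2, hs, Real.cos_zero, Real.sin_zero]
    apply main <;> (try simp only [h12, h20, h21, h02]) <;> linarith
  · have hlt : 0 < 1 - A.1 2 2 ^ 2 :=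
      sub_pos.2 (lt_of_le_of_ne ((sq_le_one_iff_abs_le_one _).2 hb) hd)
    have hs : 0 < Real.sin (eulerBeta A) := hsin ▸ Real.sqrt_pos.2 hlt
    have hs2 : Real.sin (eulerBeta A) ^ 2 = 1 - A.1 2 2 ^ 2 := by rw [hsin, Real.sq_sqrt hlt.le]
    obtain ⟨k1, k2⟩ := cos_sin_arg (a := A.1 0 2) (b := A.1 1 2) hs (by linarith)
    obtain ⟨k3, k4⟩ := cos_sin_arg (a := -A.1 2 0) (b := A.1 2 1) hs (by linarith)
    rw [eulerAlpha, eulerGamma, if_neg hd, k1, k2, k3, k4]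
    generalize Real.sin (eulerBeta A) = sb at *
    apply main <;> field_simp <;> try rw [hs2]
    · linear_combination -A.1 2 2 * a11 - a00
    · linear_combination A.1 2 2 * a10 - a01
    · linear_combination A.1 2 2 * a01 - a10
    · linear_combination -A.1 2 2 * a00 - a11

theorem measurable_entry (i j : Fin 3) : Measurable fun A : SO3 => A.1 i j :=
  (continuous_subtype_val.matrix_elem i j).measurable

theorem measurable_eulerAlpha : Measurable eulerAlpha :=
  Complex.measurable_arg.comp (Complex.measurableEquivRealProd.symm.measurable.comp
    ((measurable_entry 0 2).prodMk (measurable_entry 1 2)))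

theorem measurable_eulerBeta : Measurable eulerBeta :=
  Real.continuous_arccos.measurable.comp (measurable_entry 2 2)

theorem measurable_eulerGamma : Measurable eulerGamma :=
  Measurable.ite (measurableSet_eq_fun ((measurable_entry 2 2).pow_const 2) measurable_const)
    (Complex.measurable_arg.comp (Complex.measurableEquivRealProd.symm.measurable.comp
      ((measurable_entry 1 1).prodMk (measurable_entry 1 0))))
    (Complex.measurable_arg.comp (Complex.measurableEquivRealProd.symm.measurable.comp
      ((measurable_entry 2 0).neg.prodMk (measurable_entry 2 1))))

section
attribute [local instance] Matrix.linftyOpNormedRing Matrix.linftyOpNormedAlgebra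

theorem continuous_wignerSmallD (l : ℕ) (m n : Idx l) :
    Continuous fun β => wignerSmallD l β m n := by
  have h : Continuous (wignerSmallD l) :=
    (NormedSpace.exp_continuous (𝔸 := Matrix (Idx l) (Idx l) ℝ)).comp (by fun_prop)
  exact h.matrix_elem m n

end

theorem memLp_wignerD (l : ℕ) (m n : Idx l) : MemLp (fun A => wignerD l A m n) 2 haar := by
  obtain ⟨C, hC⟩ := (isCompact_Icc (a := (0 : ℝ)) (b := Real.pi)).exists_bound_of_continuousOn
    (continuous_wignerSmallD l m n).continuousOn
  refine MemLp.of_bound (Measurable.aestronglyMeasurable ?_) C (Filter.Eventually.of_forall ?_)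
  · have h1 := measurable_eulerAlpha
    have h2 := measurable_eulerGamma
    have h3 := (continuous_wignerSmallD l m n).measurable.comp measurable_eulerBeta
    have h3' : Measurable fun A : SO3 => (wignerSmallD l (eulerBeta A) m n : ℂ) :=
      Complex.measurable_ofReal.comp h3
    simp only [wignerD, Matrix.of_apply]
    fun_prop
  · intro A
    have e : ∀ (k : ℤ) (t : ℝ), ‖Complex.exp (-Complex.I * k * t)‖ = 1 := by
      intro k t
      simp [Complex.norm_exp]
    simp only [wignerD, Matrix.of_apply, norm_mul, e, one_mul, mul_one, Complex.norm_real]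
    exact hC _ ⟨Real.arccos_nonneg _, Real.arccos_le_pi _⟩

/-- The coefficient function `D^l_{m,n}` as an element of `L²(SO(3), ℂ)`. -/
def wignerL2 (l : ℕ) (m n : Idx l) : L2SO3 := (memLp_wignerD l m n).toLp

/-- Families `(c^l_{m,n})` of complex numbers with `l = 0, 1, 2, …` and `-l ≤ m, n ≤ l`. -/
abbrev CoeffFamily : Type := (l : ℕ) → Idx l → Idx l → ℂ

/-- `c` is a family of Fourier coefficients of `x`: with unconditional convergence in
`L²(SO(3), ℂ)`, `x` is the sum of `c^l_{-m,-n} D^l_{m,n}` over all `l` and `-l ≤ m, n ≤ l`. -/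
def HasFourierCoeffs (x : L2SO3) (c : CoeffFamily) : Prop :=
  HasSum (fun i : (l : ℕ) × (Idx l × Idx l) => c i.1 (-i.2.1) (-i.2.2) • wignerL2 i.1 i.2.1 i.2.2) x

end SO3Fourier

end

noncomputable section

namespace SO3Fourier

open Matrix

/-! The matrix `D^l` is the action of `SU(2)` on binary forms of degree `2l`, written in normalized
monomials: if `U` is a lift of `A`, then `spinMonomial l (v ᵥ* U) = spinMonomial l v ᵥ* wignerD l
A`. The lift is unique up to sign, and even degree ignores the sign. Since the monomials are
linearly independent, `D^l` is multiplicative (`wignerD_mul`), although it is defined through Euler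
angles that do not compose. Unitarity follows from the skew generator and the unimodular phases.

Schur orthogonality comes next. By invariance of the Haar measure, the Gram matrix of two columns
intertwines `D^l` and `D^{l'}`. Weights and ladder coefficients force such a matrix to vanish for `l
≠ l'` and to be scalar for `l = l'`; its trace gives the squared norm `1 / (2l+1)`
(`inner_wignerL2`).

For completeness, polarization and the identity `det U = 1` show that the even powers of the forms
`v U w` span a space stable under multiplication by the entries of `A`. That space lies in the span
of the Wigner coefficients, so it remains to apply Stone–Weierstrass and the density of continuous
functions in `L²` (`span_wignerL2_closure`). Hence the functions `√(2l+1) D^l_{m,n}` form a Hilbert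
basis, which gives existence and uniqueness of Fourier coefficients.

The covariance with `ψ` is a bounded linear operator in `x`. It sends `D^l_{m,n}` to `∑ s,
⟨D^l_{s,n}, ψ⟩⁻ D^l_{m,s}`, where `⁻` is conjugation and `⟨·,·⟩` is linear in `ψ`, so coefficients
can be computed term by term (`inner_covarianceMap`). -/

/-! ### Ladder matrices as differential operators on binary forms -/

/-- The monomial `v₀^(l+m) v₁^(l-m) / √((l+m)! (l-m)!)` in the components of a spinor `v`. -/
def spinMonomial (l : ℕ) (v : Fin 2 → ℂ) (m : Idx l) : ℂ :=
  v 0 ^ (l + m.1).toNat * v 1 ^ (l - m.1).toNat /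
    (√(((l + m.1).toNat.factorial : ℝ) * ((l - m.1).toNat.factorial : ℝ)) : ℝ)

theorem Idx.bounds {l : ℕ} (m : Idx l) : -(l : ℤ) ≤ m.1 ∧ m.1 ≤ l := Finset.mem_Icc.1 m.2

/-- The ladder matrix represents the operator `v₁ ∂/∂v₀`; the square roots in it are the ratios of
the normalizing factors of neighbouring monomials. -/
theorem sum_spinMonomial_mul_ladder (l : ℕ) (v : Fin 2 → ℂ) (m : Idx l) :
    ∑ k, spinMonomial l v k * (ladder l k m : ℂ) =
      (l + m.1).toNat * v 0 ^ ((l + m.1).toNat - 1) * v 1 ^ ((l - m.1).toNat + 1) /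
        (√(((l + m.1).toNat.factorial : ℝ) * ((l - m.1).toNat.factorial : ℝ)) : ℝ) := by
  obtain ⟨h1, h2⟩ := m.bounds
  -- At the lowest weight nothing lies below `m`, and the factor `(l + m).toNat = 0` makes the
  -- truncated exponent harmless.
  by_cases hm : -(l : ℤ) = m.1
  · have h0 : (l + m.1).toNat = 0 := by omega
    rw [h0]
    simp only [Nat.cast_zero, zero_mul, zero_div]
    refine Finset.sum_eq_zero fun k _ => ?_
    have : k.1 + 1 ≠ m.1 := by have := k.bounds; omega
    simp [ladder, this]
  · rw [Finset.sum_eq_single (⟨m.1 - 1, Finset.mem_Icc.2 (by omega)⟩ : Idx l)]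
    · obtain ⟨p, hp⟩ : ∃ p : ℕ, (l : ℤ) + m.1 = p + 1 := ⟨(l + m.1 - 1).toNat, by omega⟩
      obtain ⟨q, hq⟩ : ∃ q : ℕ, (l : ℤ) - m.1 = q := ⟨(l - m.1).toNat, by omega⟩
      have e1 : ((l : ℤ) + (m.1 - 1)).toNat = p := by omega
      have e2 : ((l : ℤ) - (m.1 - 1)).toNat = q + 1 := by omega
      have e3 : (l + m.1).toNat = p + 1 := by omega
      have e4 : (l - m.1).toNat = q := by omega
      have hpR : (l : ℝ) + m.1 = p + 1 := by exact_mod_cast hp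
      have hqR : (l : ℝ) - m.1 = q := by exact_mod_cast hq
      have e5 : ((l : ℝ) - ((m.1 - 1 : ℤ) : ℝ)) * ((l : ℝ) + ((m.1 - 1 : ℤ) : ℝ) + 1)
          = (q + 1) * (p + 1) := by
        push_cast; rw [← hpR, ← hqR]; ring
      simp only [spinMonomial, ladder, Matrix.of_apply, e1, e2, e3, e4, e5, sub_add_cancel, if_true,
        Nat.add_sub_cancel]
      have hP : (0 : ℝ) < (p.factorial : ℝ) := by positivity
      have hQ : (0 : ℝ) < (q.factorial : ℝ) := by positivity
      have key : √(((q : ℝ) + 1) * (p + 1)) * √(((p + 1).factorial : ℝ) * q.factorial) =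
          (p + 1) * √((p.factorial : ℝ) * (q + 1).factorial) := by
        rw [← Real.sqrt_mul (by positivity)]
        nth_rewrite 2 [← Real.sqrt_sq (by positivity : (0 : ℝ) ≤ p + 1)]
        rw [← Real.sqrt_mul (by positivity)]
        congr 1
        push_cast [Nat.factorial_succ]
        ring
      have n1 : √(((p + 1).factorial : ℝ) * q.factorial) ≠ 0 := by positivity
      have n2 : √((p.factorial : ℝ) * (q + 1).factorial) ≠ 0 := by positivity
      have keyC := congrArg (fun r : ℝ => (r : ℂ)) key
      push_cast at keyC
      have n1' : ((√(((p + 1).factorial : ℝ) * q.factorial) : ℝ) : ℂ) ≠ 0 := by exact_mod_cast n1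
      have n2' : ((√((p.factorial : ℝ) * (q + 1).factorial) : ℝ) : ℂ) ≠ 0 := by exact_mod_cast n2
      rw [div_mul_eq_mul_div, div_eq_div_iff n2' n1']
      push_cast
      linear_combination v 0 ^ p * v 1 ^ (q + 1) * keyC
    · intro k _ hk
      have : k.1 + 1 ≠ m.1 := fun h => hk (Subtype.ext (by simp only; omega))
      simp [ladder, this]
    · simp

theorem neg_val {l : ℕ} (m : Idx l) : (-m).1 = -m.1 := rfl

instance (l : ℕ) : InvolutiveNeg (Idx l) where
  neg_neg m := Subtype.ext (by simp [neg_val])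

theorem ladder_neg_neg (l : ℕ) (m n : Idx l) : ladder l (-m) (-n) = ladder l n m := by
  simp only [ladder, Matrix.of_apply, neg_val]
  by_cases h : n.1 + 1 = m.1
  · rw [if_pos h, if_pos (by omega)]
    rw [← h]; push_cast; congr 1; ring
  · rw [if_neg h, if_neg (by omega)]

theorem spinMonomial_neg (l : ℕ) (v : Fin 2 → ℂ) (m : Idx l) :
    spinMonomial l v (-m) = spinMonomial l ![v 1, v 0] m := by
  simp only [spinMonomial, neg_val, sub_neg_eq_add, ← sub_eq_add_neg, Matrix.cons_val_zero,
    Matrix.cons_val_one]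
  rw [mul_comm (v 0 ^ _), mul_comm (((l - m.1).toNat.factorial : ℝ))]

/-- The transpose represents `v₀ ∂/∂v₁`: exchanging the two components of `v` corresponds to `m ↦
-m`, which transposes the ladder matrix. -/
theorem sum_spinMonomial_mul_ladder_transpose (l : ℕ) (v : Fin 2 → ℂ) (m : Idx l) :
    ∑ k, spinMonomial l v k * (ladder l m k : ℂ) =
      (l - m.1).toNat * v 0 ^ ((l + m.1).toNat + 1) * v 1 ^ ((l - m.1).toNat - 1) /
        (√(((l + m.1).toNat.factorial : ℝ) * ((l - m.1).toNat.factorial : ℝ)) : ℝ) := by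
  have h := sum_spinMonomial_mul_ladder l ![v 1, v 0] (-m)
  rw [← Equiv.sum_comp (Equiv.neg (Idx l))
    fun k => spinMonomial l ![v 1, v 0] k * (ladder l k (-m) : ℂ)] at h
  simp only [Equiv.neg_apply, ladder_neg_neg, spinMonomial_neg] at h
  simp only [neg_val, sub_neg_eq_add, ← sub_eq_add_neg, Matrix.cons_val_zero,
    Matrix.cons_val_one, mul_comm (((l - m.1).toNat.factorial : ℝ))] at h
  have hv : ![v 0, v 1] = v := by
    ext i; fin_cases i <;> rfl
  rw [hv] at h
  rw [h]
  ring

/-- The skew-symmetric generator `Q^l - (Q^l)ᵀ`. -/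
def generator (l : ℕ) : Matrix (Idx l) (Idx l) ℝ := ladder l - (ladder l).transpose

theorem generator_apply (l : ℕ) (m n : Idx l) :
    generator l m n = ladder l m n - ladder l n m := rfl

theorem sum_spinMonomial_mul_generator (l : ℕ) (v : Fin 2 → ℂ) (m : Idx l) :
    ∑ k, spinMonomial l v k * (generator l k m : ℂ) =
      ((l + m.1).toNat * v 0 ^ ((l + m.1).toNat - 1) * v 1 ^ ((l - m.1).toNat + 1) -
        (l - m.1).toNat * v 0 ^ ((l + m.1).toNat + 1) * v 1 ^ ((l - m.1).toNat - 1)) /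
        (√(((l + m.1).toNat.factorial : ℝ) * ((l - m.1).toNat.factorial : ℝ)) : ℝ) := by
  rw [sub_div, ← sum_spinMonomial_mul_ladder, ← sum_spinMonomial_mul_ladder_transpose,
    ← Finset.sum_sub_distrib]
  refine Finset.sum_congr rfl fun k _ => ?_
  rw [generator_apply]; push_cast; ring

section
attribute [local instance] Matrix.linftyOpNormedRing Matrix.linftyOpNormedAlgebra

theorem hasDerivAt_wignerSmallD (l : ℕ) (m n : Idx l) (β : ℝ) :
    HasDerivAt (fun t => wignerSmallD l t m n)
      (1 / 2 * ∑ k, generator l m k * wignerSmallD l β k n) β := by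
  have h := hasDerivAt_exp_smul_const' (𝔸 := Matrix (Idx l) (Idx l) ℝ) (generator l) (β / 2)
  have h2 := HasDerivAt.scomp β h ((hasDerivAt_id β).div_const 2)
  have h3 := hasDerivAt_pi.1 (hasDerivAt_pi.1 h2 m) n
  refine h3.congr_deriv ?_
  rw [Matrix.smul_apply, Matrix.mul_apply, smul_eq_mul]
  rfl

end

theorem wignerSmallD_zero (l : ℕ) : wignerSmallD l 0 = 1 := by
  simp [wignerSmallD, NormedSpace.exp_zero]

theorem wignerSmallD_transpose (l : ℕ) (β : ℝ) :
    (wignerSmallD l β).transpose = wignerSmallD l (-β) := by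
  rw [wignerSmallD, wignerSmallD, ← Matrix.exp_transpose]
  congr 1
  rw [Matrix.transpose_smul, Matrix.transpose_sub, Matrix.transpose_transpose, neg_div, neg_smul,
    ← smul_neg, neg_sub]

theorem wignerSmallD_neg_mul (l : ℕ) (β : ℝ) : wignerSmallD l (-β) * wignerSmallD l β = 1 := by
  rw [wignerSmallD, wignerSmallD, ← Matrix.exp_add_of_commute]
  · rw [← add_smul]; simp [neg_div, NormedSpace.exp_zero]
  · exact ((Commute.refl _).smul_left _).smul_right _

/-! ### Wigner matrices as the action of `SU(2)` on binary forms -/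

/-- The lift of the rotation around the `z`-axis to `SU(2)`. -/
def spinZ (θ : ℝ) : Matrix (Fin 2) (Fin 2) ℂ :=
  !![Complex.exp (-Complex.I * (θ / 2)), 0; 0, Complex.exp (Complex.I * (θ / 2))]

/-- The lift of the rotation around the `y`-axis to `SU(2)`. -/
def spinY (θ : ℝ) : Matrix (Fin 2) (Fin 2) ℂ :=
  !![(Real.cos (θ / 2) : ℂ), -(Real.sin (θ / 2) : ℂ); (Real.sin (θ / 2) : ℂ), (Real.cos (θ / 2) : ℂ)]

theorem spinMonomial_vecMul_spinZ (l : ℕ) (v : Fin 2 → ℂ) (θ : ℝ) (m : Idx l) :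
    spinMonomial l (v ᵥ* spinZ θ) m =
      spinMonomial l v m * Complex.exp (-Complex.I * m.1 * θ) := by
  obtain ⟨h1, h2⟩ := m.bounds
  have h : Complex.exp (-Complex.I * m.1 * θ) =
      Complex.exp (-Complex.I * (θ / 2)) ^ (l + m.1).toNat *
        Complex.exp (Complex.I * (θ / 2)) ^ (l - m.1).toNat := by
    rw [← Complex.exp_nat_mul, ← Complex.exp_nat_mul, ← Complex.exp_add]
    congr 1
    have e1 : (((l + m.1).toNat : ℕ) : ℂ) = l + m.1 := by
      have : (((l + m.1).toNat : ℕ) : ℤ) = l + m.1 := by omega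
      exact_mod_cast congrArg (fun z : ℤ => (z : ℂ)) this
    have e2 : (((l - m.1).toNat : ℕ) : ℂ) = l - m.1 := by
      have : (((l - m.1).toNat : ℕ) : ℤ) = l - m.1 := by omega
      exact_mod_cast congrArg (fun z : ℤ => (z : ℂ)) this
    rw [e1, e2]; ring
  have v0 : (v ᵥ* spinZ θ) 0 = v 0 * Complex.exp (-Complex.I * (θ / 2)) := by
    simp [Matrix.vecMul, dotProduct, spinZ]
  have v1 : (v ᵥ* spinZ θ) 1 = v 1 * Complex.exp (Complex.I * (θ / 2)) := by
    simp [Matrix.vecMul, dotProduct, spinZ]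
  rw [h, spinMonomial, spinMonomial, v0, v1, mul_pow, mul_pow]
  ring

theorem hasDerivAt_spinMonomial_vecMul_spinY (l : ℕ) (v : Fin 2 → ℂ) (m : Idx l) (β : ℝ) :
    HasDerivAt (fun t : ℝ => spinMonomial l (v ᵥ* spinY t) m)
      (1 / 2 * ∑ k, spinMonomial l (v ᵥ* spinY β) k * (generator l k m : ℂ)) β := by
  have v0 : ∀ t, (v ᵥ* spinY t) 0 = v 0 * (Real.cos (t / 2) : ℂ) + v 1 * (Real.sin (t / 2) : ℂ) := by
    intro t; simp [Matrix.vecMul, dotProduct, spinY, Fin.sum_univ_two]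
  have v1 : ∀ t, (v ᵥ* spinY t) 1 = v 1 * (Real.cos (t / 2) : ℂ) - v 0 * (Real.sin (t / 2) : ℂ) := by
    intro t; simp [Matrix.vecMul, dotProduct, spinY, Fin.sum_univ_two]; ring
  have hc : HasDerivAt (fun t : ℝ => (Real.cos (t / 2) : ℂ)) (-(Real.sin (β / 2) : ℂ) * (1 / 2)) β := by
    exact ((hasDerivAt_id β).div_const 2).cos.ofReal_comp.congr_deriv (by simp)
  have hs : HasDerivAt (fun t : ℝ => (Real.sin (t / 2) : ℂ)) ((Real.cos (β / 2) : ℂ) * (1 / 2)) β := by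
    exact ((hasDerivAt_id β).div_const 2).sin.ofReal_comp.congr_deriv (by simp)
  have h0 : HasDerivAt (fun t : ℝ => (v ᵥ* spinY t) 0) (1 / 2 * (v ᵥ* spinY β) 1) β := by
    simp only [v0, v1]
    exact ((hc.const_mul (v 0)).add (hs.const_mul (v 1))).congr_deriv (by ring)
  have h1 : HasDerivAt (fun t : ℝ => (v ᵥ* spinY t) 1) (-(1 / 2 * (v ᵥ* spinY β) 0)) β := by
    simp only [v0, v1]
    exact ((hc.const_mul (v 1)).sub (hs.const_mul (v 0))).congr_deriv (by ring)
  rw [sum_spinMonomial_mul_generator]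
  refine (((h0.pow (l + m.1).toNat).mul (h1.pow (l - m.1).toNat)).div_const _).congr_deriv ?_
  simp only [Pi.pow_apply, pow_succ]
  ring

/-- Both sides solve the same linear differential equation in `β` with the same initial value. -/
theorem spinMonomial_vecMul_spinY (l : ℕ) (v : Fin 2 → ℂ) (β : ℝ) :
    spinMonomial l (v ᵥ* spinY β) =
      spinMonomial l v ᵥ* (wignerSmallD l β).map ((↑) : ℝ → ℂ) := by
  -- Multiplying by the inverse `d^l(-t)` turns uniqueness for the equation into the constancy of
  -- one function.
  have hconst : ∀ t : ℝ, spinMonomial l (v ᵥ* spinY t) ᵥ*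
      (wignerSmallD l (-t)).map ((↑) : ℝ → ℂ) = spinMonomial l v := by
    intro t
    ext n
    have hd : ∀ t : ℝ, HasDerivAt (fun t : ℝ => ∑ m, spinMonomial l (v ᵥ* spinY t) m *
        (wignerSmallD l (-t) m n : ℂ)) 0 t := by
      intro t
      have h1 : ∀ m, HasDerivAt (fun t : ℝ => (wignerSmallD l (-t) m n : ℂ))
          (-((1 / 2 * ∑ k, generator l m k * wignerSmallD l (-t) k n : ℝ) : ℂ)) t := by
        intro m
        have := (HasDerivAt.scomp t (hasDerivAt_wignerSmallD l m n (-t)) (hasDerivAt_neg t)).ofReal_comp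
        refine this.congr_deriv ?_
        simp
      have := HasDerivAt.fun_sum (u := Finset.univ) fun m _ =>
        (hasDerivAt_spinMonomial_vecMul_spinY l v m t).mul (h1 m)
      refine this.congr_deriv ?_
      rw [Finset.sum_add_distrib]
      push_cast
      simp only [Finset.mul_sum, Finset.sum_mul, mul_neg, Finset.sum_neg_distrib]
      rw [Finset.sum_comm, ← sub_eq_add_neg, sub_eq_zero]
      refine Finset.sum_congr rfl fun i _ => Finset.sum_congr rfl fun j _ => by ring
    have h := is_const_of_deriv_eq_zero (fun t => (hd t).differentiableAt)
      (fun t => (hd t).deriv) t 0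
    have hone : spinY 0 = 1 := by
      ext i j; fin_cases i <;> fin_cases j <;> simp [spinY]
    simp only [neg_zero, wignerSmallD_zero, hone, Matrix.vecMul_one, Matrix.one_apply] at h
    simpa [Matrix.vecMul, dotProduct, -Finset.univ_eq_attach, apply_ite] using h
  have h := congrArg (· ᵥ* (wignerSmallD l β).map ((↑) : ℝ → ℂ)) (hconst β)
  simp only [Matrix.vecMul_vecMul] at h
  have hm := Matrix.map_mul (L := wignerSmallD l (-β)) (M := wignerSmallD l β) (f := Complex.ofRealHom)
  rw [wignerSmallD_neg_mul, Matrix.map_one _ (map_zero _) (map_one _)] at hm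
  rw [← h]
  exact (Matrix.vecMul_one _).symm.trans (congrArg (spinMonomial l (v ᵥ* spinY β) ᵥ* ·) hm)

/-- The lift to `SU(2)` given by the Euler angles. -/
def spinLift (A : SO3) : Matrix (Fin 2) (Fin 2) ℂ :=
  spinZ (eulerAlpha A) * spinY (eulerBeta A) * spinZ (eulerGamma A)

theorem spinMonomial_vecMul_spinLift (l : ℕ) (v : Fin 2 → ℂ) (A : SO3) :
    spinMonomial l (v ᵥ* spinLift A) = spinMonomial l v ᵥ* wignerD l A := by
  ext n
  rw [spinLift, ← Matrix.vecMul_vecMul, ← Matrix.vecMul_vecMul, spinMonomial_vecMul_spinZ,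
    spinMonomial_vecMul_spinY]
  simp only [Matrix.vecMul, dotProduct, Matrix.map_apply, spinMonomial_vecMul_spinZ, wignerD,
    Matrix.of_apply, Finset.sum_mul]
  refine Finset.sum_congr rfl fun m _ => by ring

theorem eq_zero_of_sum_spinMonomial (l : ℕ) (c : Idx l → ℂ)
    (h : ∀ v, ∑ m, spinMonomial l v m * c m = 0) : c = 0 := by
  let P : Polynomial ℂ := ∑ m : Idx l, Polynomial.monomial (l + m.1).toNat
    (c m / (√(((l + m.1).toNat.factorial : ℝ) * ((l - m.1).toNat.factorial : ℝ)) : ℝ))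
  have hP : P = 0 := by
    refine Polynomial.funext fun t => ?_
    -- On the line `v = (t, 1)` the monomials become distinct powers of `t`.
    rw [Polynomial.eval_zero, ← h ![t, 1]]
    simp only [P, Polynomial.eval_finsetSum, Polynomial.eval_monomial, spinMonomial,
      Matrix.cons_val_zero, Matrix.cons_val_one, one_pow]
    exact Finset.sum_congr rfl fun m _ => by ring
  ext n
  have hn := congrArg (fun p => p.coeff (l + n.1).toNat) hP
  simp only [P, Polynomial.finsetSum_coeff, Polynomial.coeff_monomial, Polynomial.coeff_zero] at hn
  rw [Finset.sum_eq_single n (fun m _ hm => if_neg fun e => hm (Subtype.ext ?_)) (by simp),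
    if_pos rfl, div_eq_zero_iff] at hn
  · refine hn.resolve_right ?_
    have : √(((l + n.1).toNat.factorial : ℝ) * ((l - n.1).toNat.factorial : ℝ)) ≠ 0 := by positivity
    exact_mod_cast this
  · have := m.bounds
    have := n.bounds
    omega

theorem eq_of_spinMonomial_vecMul_eq (l : ℕ) (M N : Matrix (Idx l) (Idx l) ℂ)
    (h : ∀ v, spinMonomial l v ᵥ* M = spinMonomial l v ᵥ* N) : M = N := by
  ext m n
  have := eq_zero_of_sum_spinMonomial l (fun m => M m n - N m n) fun v => by
    have := congrFun (h v) n
    simp only [Matrix.vecMul, dotProduct] at this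
    simp only [mul_sub, Finset.sum_sub_distrib, this, sub_self]
  exact sub_eq_zero.1 (congrFun this m)

theorem spinMonomial_neg_vec (l : ℕ) (v : Fin 2 → ℂ) : spinMonomial l (-v) = spinMonomial l v := by
  ext m
  have := m.bounds
  have h : (-1 : ℂ) ^ ((l + m.1).toNat) * (-1) ^ ((l - m.1).toNat) = 1 := by
    rw [← pow_add]
    exact Even.neg_one_pow ⟨l, by omega⟩
  simp only [spinMonomial, Pi.neg_apply]
  rw [neg_pow (v 0), neg_pow (v 1)]
  linear_combination (v 0 ^ (l + m.1).toNat * v 1 ^ (l - m.1).toNat /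
    (√(((l + m.1).toNat.factorial : ℝ) * ((l - m.1).toNat.factorial : ℝ)) : ℝ)) * h

/-! ### The double cover of `SO(3)` and multiplicativity of `D^l` -/

/-- The matrix of `X ↦ U X adj(U)` on traceless `2 × 2` matrices in the basis of Pauli matrices. -/
def spinAdjoint (U : Matrix (Fin 2) (Fin 2) ℂ) : Matrix (Fin 3) (Fin 3) ℂ :=
  !![(U 0 0 ^ 2 - U 0 1 ^ 2 + U 1 1 ^ 2 - U 1 0 ^ 2) / 2,
      Complex.I * ((U 1 1 ^ 2 + U 1 0 ^ 2 - U 0 0 ^ 2 - U 0 1 ^ 2) / 2),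
      U 1 0 * U 1 1 - U 0 0 * U 0 1;
    Complex.I * ((U 0 0 ^ 2 - U 0 1 ^ 2 + U 1 0 ^ 2 - U 1 1 ^ 2) / 2),
      (U 0 0 ^ 2 + U 0 1 ^ 2 + U 1 0 ^ 2 + U 1 1 ^ 2) / 2,
      Complex.I * -(U 0 0 * U 0 1 + U 1 0 * U 1 1);
    U 0 1 * U 1 1 - U 0 0 * U 1 0,
      Complex.I * (U 0 0 * U 1 0 + U 0 1 * U 1 1),
      U 0 0 * U 1 1 + U 0 1 * U 1 0]

theorem spinAdjoint_mul (U V : Matrix (Fin 2) (Fin 2) ℂ) :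
    spinAdjoint (U * V) = spinAdjoint U * spinAdjoint V := by
  ext i j
  fin_cases i <;> fin_cases j <;>
    simp [spinAdjoint, Matrix.mul_apply, Fin.sum_univ_three, Fin.sum_univ_two] <;>
    ring_nf <;> (try simp only [Complex.I_sq]) <;> ring_nf

/-- One nonzero coordinate fixes the sign, and cancelling it carries the sign to all other
coordinates. -/
theorem eq_or_eq_neg_of_mul_eq_mul {ι : Type*} {u v : ι → ℂ} (h : ∀ i j, u i * u j = v i * v j) :
    u = v ∨ u = -v := by
  by_cases hu : ∃ i, u i ≠ 0
  · obtain ⟨i, hi⟩ := hu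
    rcases mul_self_eq_mul_self_iff.1 (h i i) with hv | hv
    · left
      ext j
      refine mul_left_cancel₀ hi ?_
      rw [h i j, hv]
    · right
      ext j
      refine mul_left_cancel₀ hi ?_
      rw [h i j, hv, Pi.neg_apply, neg_mul_neg]
  · push Not at hu
    left
    ext j
    have := h j j
    rw [hu j, zero_mul, eq_comm, mul_self_eq_zero] at this
    rw [hu j, this]

/-- The kernel of the double cover is `±1`. The entries of `spinAdjoint U` together with `det U`
determine linearly all products of two entries of `U`, hence `U` up to sign. -/
theorem eq_or_eq_neg_of_spinAdjoint_eq {U V : Matrix (Fin 2) (Fin 2) ℂ} (hU : U.det = 1)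
    (hV : V.det = 1) (h : spinAdjoint U = spinAdjoint V) : U = V ∨ U = -V := by
  have hd := hU.trans hV.symm
  rw [Matrix.det_fin_two, Matrix.det_fin_two] at hd
  have e : ∀ i j, spinAdjoint U i j = spinAdjoint V i j := fun i j => by rw [h]
  have xx := e 0 0
  have xy := e 0 1
  have xz := e 0 2
  have yx := e 1 0
  have yy := e 1 1
  have yz := e 1 2
  have zx := e 2 0
  have zy := e 2 1
  have zz := e 2 2
  simp only [spinAdjoint, Matrix.of_apply, Matrix.cons_val] at xx xy xz yx yy yz zx zy zz
  replace xy := mul_left_cancel₀ Complex.I_ne_zero xy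
  replace yx := mul_left_cancel₀ Complex.I_ne_zero yx
  replace yz := mul_left_cancel₀ Complex.I_ne_zero yz
  replace zy := mul_left_cancel₀ Complex.I_ne_zero zy
  have aa : U 0 0 * U 0 0 = V 0 0 * V 0 0 := by linear_combination (xx + yy + yx - xy) / 2
  have dd : U 1 1 * U 1 1 = V 1 1 * V 1 1 := by linear_combination (xx + yy - yx + xy) / 2
  have bb : U 0 1 * U 0 1 = V 0 1 * V 0 1 := by linear_combination (yy - xx - yx - xy) / 2
  have cc : U 1 0 * U 1 0 = V 1 0 * V 1 0 := by linear_combination (yy - xx + yx + xy) / 2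
  have ab : U 0 0 * U 0 1 = V 0 0 * V 0 1 := by linear_combination (-xz - yz) / 2
  have cd : U 1 0 * U 1 1 = V 1 0 * V 1 1 := by linear_combination (xz - yz) / 2
  have ac : U 0 0 * U 1 0 = V 0 0 * V 1 0 := by linear_combination (zy - zx) / 2
  have bd : U 0 1 * U 1 1 = V 0 1 * V 1 1 := by linear_combination (zy + zx) / 2
  have ad : U 0 0 * U 1 1 = V 0 0 * V 1 1 := by linear_combination (zz + hd) / 2
  have bc : U 0 1 * U 1 0 = V 0 1 * V 1 0 := by linear_combination (zz - hd) / 2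
  have key := eq_or_eq_neg_of_mul_eq_mul (u := fun p : Fin 2 × Fin 2 => U p.1 p.2)
    (v := fun p : Fin 2 × Fin 2 => V p.1 p.2) (by
      rintro ⟨i, j⟩ ⟨i', j'⟩
      fin_cases i <;> fin_cases j <;> fin_cases i' <;> fin_cases j' <;>
        first
          | assumption
          | exact (mul_comm _ _).trans (ab.trans (mul_comm _ _))
          | exact (mul_comm _ _).trans (cd.trans (mul_comm _ _))
          | exact (mul_comm _ _).trans (ac.trans (mul_comm _ _))
          | exact (mul_comm _ _).trans (bd.trans (mul_comm _ _))
          | exact (mul_comm _ _).trans (ad.trans (mul_comm _ _))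
          | exact (mul_comm _ _).trans (bc.trans (mul_comm _ _)))
  refine key.imp (fun k => ?_) fun k => ?_ <;> ext i j <;> exact congrFun k (i, j)

theorem ofReal_cos_half (θ : ℝ) : (Real.cos θ : ℂ) =
    (Real.cos (θ / 2) : ℂ) ^ 2 - (Real.sin (θ / 2) : ℂ) ^ 2 := by
  have : Real.cos θ = Real.cos (θ / 2) ^ 2 - Real.sin (θ / 2) ^ 2 := by
    rw [← Real.cos_two_mul', mul_div_cancel₀ _ two_ne_zero]
  exact_mod_cast congrArg (fun r : ℝ => (r : ℂ)) this

theorem ofReal_sin_half (θ : ℝ) : (Real.sin θ : ℂ) =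
    2 * (Real.sin (θ / 2) : ℂ) * (Real.cos (θ / 2) : ℂ) := by
  have : Real.sin θ = 2 * Real.sin (θ / 2) * Real.cos (θ / 2) := by
    rw [← Real.sin_two_mul, mul_div_cancel₀ _ two_ne_zero]
  exact_mod_cast congrArg (fun r : ℝ => (r : ℂ)) this

theorem ofReal_sin_sq_add_cos_sq (θ : ℝ) : (Real.sin θ : ℂ) ^ 2 + (Real.cos θ : ℂ) ^ 2 = 1 := by
  exact_mod_cast congrArg (fun r : ℝ => (r : ℂ)) (Real.sin_sq_add_cos_sq θ)

theorem spinZ_eq (θ : ℝ) : spinZ θ =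
    !![(Real.cos (θ / 2) : ℂ) - Complex.I * (Real.sin (θ / 2) : ℂ), 0;
      0, (Real.cos (θ / 2) : ℂ) + Complex.I * (Real.sin (θ / 2) : ℂ)] := by
  have h1 : Complex.exp (Complex.I * (θ / 2)) =
      (Real.cos (θ / 2) : ℂ) + Complex.I * (Real.sin (θ / 2) : ℂ) := by
    rw [mul_comm, Complex.exp_mul_I]; push_cast; ring
  have h2 : Complex.exp (-Complex.I * (θ / 2)) =
      (Real.cos (θ / 2) : ℂ) - Complex.I * (Real.sin (θ / 2) : ℂ) := by
    rw [show -Complex.I * (θ / 2 : ℂ) = (-(θ / 2)) * Complex.I by ring, Complex.exp_mul_I,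
      Complex.cos_neg, Complex.sin_neg]
    push_cast; ring
  rw [spinZ, h1, h2]

theorem det_spinZ (θ : ℝ) : (spinZ θ).det = 1 := by
  rw [spinZ_eq, Matrix.det_fin_two_of]
  linear_combination ofReal_sin_sq_add_cos_sq (θ / 2) - (Real.sin (θ / 2) : ℂ) ^ 2 * Complex.I_sq

theorem det_spinY (θ : ℝ) : (spinY θ).det = 1 := by
  rw [spinY, Matrix.det_fin_two_of]
  linear_combination ofReal_sin_sq_add_cos_sq (θ / 2)

theorem spinAdjoint_spinZ (θ : ℝ) : spinAdjoint (spinZ θ) = (rotZ θ).map ((↑) : ℝ → ℂ) := by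
  have h1 := ofReal_cos_half θ
  have h2 := ofReal_sin_half θ
  have h3 := ofReal_sin_sq_add_cos_sq (θ / 2)
  rw [spinZ_eq]
  ext i j
  fin_cases i <;> fin_cases j <;> simp [spinAdjoint, rotZ, -Complex.ofReal_cos, -Complex.ofReal_sin]
  · rw [h1]; linear_combination (Real.sin (θ / 2) : ℂ) ^ 2 * Complex.I_sq
  · rw [h2]; linear_combination 2 * (Real.sin (θ / 2) : ℂ) * (Real.cos (θ / 2) : ℂ) * Complex.I_sq
  · rw [h2]; linear_combination -2 * (Real.sin (θ / 2) : ℂ) * (Real.cos (θ / 2) : ℂ) * Complex.I_sq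
  · rw [h1]; linear_combination (Real.sin (θ / 2) : ℂ) ^ 2 * Complex.I_sq
  · linear_combination h3 - (Real.sin (θ / 2) : ℂ) ^ 2 * Complex.I_sq

theorem spinAdjoint_spinY (θ : ℝ) : spinAdjoint (spinY θ) = (rotY θ).map ((↑) : ℝ → ℂ) := by
  have h1 := ofReal_cos_half θ
  have h2 := ofReal_sin_half θ
  have h3 := ofReal_sin_sq_add_cos_sq (θ / 2)
  rw [spinY]
  ext i j
  fin_cases i <;> fin_cases j <;> simp [spinAdjoint, rotY, -Complex.ofReal_cos, -Complex.ofReal_sin]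
  · linear_combination -h1
  · linear_combination -h2
  · linear_combination h3
  · ring
  · linear_combination h2
  · ring
  · linear_combination -h1

theorem det_spinLift (A : SO3) : (spinLift A).det = 1 := by
  simp [spinLift, det_spinZ, det_spinY]

theorem map_mul_ofReal (M N : Matrix (Fin 3) (Fin 3) ℝ) :
    (M * N).map ((↑) : ℝ → ℂ) = M.map ((↑) : ℝ → ℂ) * N.map ((↑) : ℝ → ℂ) :=
  Matrix.map_mul (f := Complex.ofRealHom)

theorem spinAdjoint_spinLift (A : SO3) : spinAdjoint (spinLift A) = A.1.map ((↑) : ℝ → ℂ) := by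
  rw [euler_decomposition A, map_mul_ofReal, map_mul_ofReal, spinLift, spinAdjoint_mul,
    spinAdjoint_mul, spinAdjoint_spinZ, spinAdjoint_spinZ, spinAdjoint_spinY]

/-- This frees `D^l` from the chosen Euler angles: any lift of `A` differs from `spinLift A` by a
sign at most, and the forms have even degree. -/
theorem spinMonomial_vecMul_of_spinAdjoint_eq (l : ℕ) {U : Matrix (Fin 2) (Fin 2) ℂ} {A : SO3}
    (hU : U.det = 1) (hA : spinAdjoint U = A.1.map ((↑) : ℝ → ℂ)) (v : Fin 2 → ℂ) :
    spinMonomial l (v ᵥ* U) = spinMonomial l v ᵥ* wignerD l A := by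
  rw [← spinMonomial_vecMul_spinLift]
  rcases eq_or_eq_neg_of_spinAdjoint_eq hU (det_spinLift A)
    (hA.trans (spinAdjoint_spinLift A).symm) with h | h
  · rw [h]
  · rw [h, Matrix.vecMul_neg, spinMonomial_neg_vec]

theorem wignerD_mul (l : ℕ) (A B : SO3) : wignerD l (A * B) = wignerD l A * wignerD l B := by
  refine eq_of_spinMonomial_vecMul_eq l _ _ fun v => ?_
  rw [← spinMonomial_vecMul_of_spinAdjoint_eq l (U := spinLift A * spinLift B),
    ← Matrix.vecMul_vecMul, spinMonomial_vecMul_spinLift, spinMonomial_vecMul_spinLift,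
    Matrix.vecMul_vecMul]
  · simp [det_spinLift]
  · rw [spinAdjoint_mul, spinAdjoint_spinLift, spinAdjoint_spinLift, ← map_mul_ofReal]
    rfl

theorem exists_coe_eq_rotZ (θ : ℝ) : ∃ A : SO3, A.1 = rotZ θ := by
  refine ⟨⟨rotZ θ, Matrix.mem_specialOrthogonalGroup_iff.2
    ⟨(Matrix.mem_orthogonalGroup_iff (Fin 3) ℝ).2 ?_, ?_⟩⟩, rfl⟩
  · ext i j
    fin_cases i <;> fin_cases j <;>
      simp [rotZ, Matrix.mul_apply, Fin.sum_univ_three] <;>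
      first | ring1 | linear_combination Real.sin_sq_add_cos_sq θ
  · simp [rotZ, Matrix.det_fin_three]
    linear_combination Real.sin_sq_add_cos_sq θ

theorem exists_coe_eq_rotY (θ : ℝ) : ∃ A : SO3, A.1 = rotY θ := by
  refine ⟨⟨rotY θ, Matrix.mem_specialOrthogonalGroup_iff.2
    ⟨(Matrix.mem_orthogonalGroup_iff (Fin 3) ℝ).2 ?_, ?_⟩⟩, rfl⟩
  · ext i j
    fin_cases i <;> fin_cases j <;>
      simp [rotY, Matrix.mul_apply, Fin.sum_univ_three] <;>
      first | ring1 | linear_combination Real.sin_sq_add_cos_sq θ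
  · simp [rotY, Matrix.det_fin_three]
    linear_combination Real.sin_sq_add_cos_sq θ

theorem wignerD_of_coe_eq_rotZ (l : ℕ) {θ : ℝ} {A : SO3} (hA : A.1 = rotZ θ) :
    wignerD l A = Matrix.diagonal fun m : Idx l => Complex.exp (-Complex.I * m.1 * θ) := by
  refine eq_of_spinMonomial_vecMul_eq l _ _ fun v => ?_
  rw [← spinMonomial_vecMul_of_spinAdjoint_eq l (det_spinZ θ)
    ((spinAdjoint_spinZ θ).trans (by rw [hA]))]
  ext m
  rw [spinMonomial_vecMul_spinZ, Matrix.vecMul_diagonal]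

theorem wignerD_of_coe_eq_rotY (l : ℕ) {θ : ℝ} {A : SO3} (hA : A.1 = rotY θ) :
    wignerD l A = (wignerSmallD l θ).map ((↑) : ℝ → ℂ) := by
  refine eq_of_spinMonomial_vecMul_eq l _ _ fun v => ?_
  rw [← spinMonomial_vecMul_of_spinAdjoint_eq l (det_spinY θ)
    ((spinAdjoint_spinY θ).trans (by rw [hA])), spinMonomial_vecMul_spinY]

/-- `d^l` is orthogonal as the exponential of a skew matrix, and the outer factors are unimodular
phases. -/
theorem conjTranspose_mul_wignerD (l : ℕ) (A : SO3) : (wignerD l A)ᴴ * wignerD l A = 1 := by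
  have e : ∀ (k : ℤ) (t : ℝ), starRingEnd ℂ (Complex.exp (-Complex.I * k * t)) *
      Complex.exp (-Complex.I * k * t) = 1 := by
    intro k t
    rw [mul_comm, Complex.mul_conj, Complex.normSq_eq_norm_sq]
    simp [Complex.norm_exp]
  ext m n
  have h : ∑ k, wignerSmallD l (eulerBeta A) k m * wignerSmallD l (eulerBeta A) k n =
      (1 : Matrix (Idx l) (Idx l) ℝ) m n := by
    rw [← wignerSmallD_neg_mul l (eulerBeta A), ← wignerSmallD_transpose, Matrix.mul_apply]
    rfl
  have hC := congrArg (fun r : ℝ => (r : ℂ)) h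
  simp only [Complex.ofReal_sum, Complex.ofReal_mul] at hC
  have : ((wignerD l A)ᴴ * wignerD l A) m n =
      starRingEnd ℂ (Complex.exp (-Complex.I * m.1 * eulerGamma A)) *
        (((1 : Matrix (Idx l) (Idx l) ℝ) m n : ℝ) : ℂ) *
        Complex.exp (-Complex.I * n.1 * eulerGamma A) := by
    rw [← hC, Matrix.mul_apply, Finset.mul_sum, Finset.sum_mul]
    refine Finset.sum_congr rfl fun k _ => ?_
    rw [Matrix.conjTranspose_apply]
    simp only [wignerD, Matrix.of_apply, RCLike.star_def, map_mul, Complex.conj_ofReal]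
    linear_combination (starRingEnd ℂ (Complex.exp (-Complex.I * m.1 * eulerGamma A)) *
        (wignerSmallD l (eulerBeta A) k m : ℂ) * (wignerSmallD l (eulerBeta A) k n : ℂ) *
        Complex.exp (-Complex.I * n.1 * eulerGamma A)) * e k.1 (eulerAlpha A)
  rw [this]
  by_cases hmn : m = n
  · subst hmn
    rw [Matrix.one_apply_eq, Matrix.one_apply_eq]
    simpa using e m.1 (eulerGamma A)
  · rw [Matrix.one_apply_ne hmn, Matrix.one_apply_ne hmn]; simp

/-! ### Schur's lemma by weights and ladder coefficients -/

/-- Intertwiners between `D^l` and `D^{l'}` commute with the weights. -/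
theorem intertwiner_apply_eq_zero {l l' : ℕ} {T : Matrix (Idx l) (Idx l') ℂ}
    (hT : ∀ A, wignerD l A * T = T * wignerD l' A) {m : Idx l} {n : Idx l'} (hmn : m.1 ≠ n.1) :
    T m n = 0 := by
  -- At this angle the characters of weights `m` and `n` differ by the factor `exp(-iπ) = -1`.
  obtain ⟨A, hA⟩ := exists_coe_eq_rotZ (Real.pi / (m.1 - n.1 : ℤ))
  have h := congrFun (congrFun (hT A) m) n
  rw [wignerD_of_coe_eq_rotZ l hA, wignerD_of_coe_eq_rotZ l' hA, Matrix.diagonal_mul,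
    Matrix.mul_diagonal] at h
  have hne : ((m.1 : ℂ) - n.1) ≠ 0 := by
    rw [sub_ne_zero]; exact_mod_cast hmn
  have h2 : Complex.exp (-Complex.I * m.1 * (Real.pi / (m.1 - n.1 : ℤ) : ℝ)) =
      - Complex.exp (-Complex.I * n.1 * (Real.pi / (m.1 - n.1 : ℤ) : ℝ)) := by
    have : -Complex.I * m.1 * ((Real.pi / (m.1 - n.1 : ℤ) : ℝ) : ℂ) =
        -Complex.I * n.1 * ((Real.pi / (m.1 - n.1 : ℤ) : ℝ) : ℂ) + -(Real.pi * Complex.I) := by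
      push_cast
      field_simp
      ring
    rw [this, Complex.exp_add, Complex.exp_neg, Complex.exp_pi_mul_I]
    norm_num
  rw [h2] at h
  have h3 := Complex.exp_ne_zero (-Complex.I * n.1 * (Real.pi / (m.1 - n.1 : ℤ) : ℝ))
  have h4 : 2 * Complex.exp (-Complex.I * n.1 * (Real.pi / (m.1 - n.1 : ℤ) : ℝ)) * T m n = 0 := by
    linear_combination -h
  simpa [h3] using h4

theorem hasDerivAt_wignerSmallD_zero (l : ℕ) (m n : Idx l) :
    HasDerivAt (fun t : ℝ => (wignerSmallD l t m n : ℂ)) (1 / 2 * (generator l m n : ℂ)) 0 := by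
  refine (hasDerivAt_wignerSmallD l m n 0).ofReal_comp.congr_deriv ?_
  have : ∑ k, generator l m k * wignerSmallD l 0 k n = generator l m n := by
    rw [wignerSmallD_zero, ← Matrix.mul_apply, Matrix.mul_one]
  rw [this]; push_cast; ring

/-- This is the derivative at `t = 0` of the intertwining relation for the rotations `Y(t)`. -/
theorem generator_intertwiner {l l' : ℕ} {T : Matrix (Idx l) (Idx l') ℂ}
    (hT : ∀ A, wignerD l A * T = T * wignerD l' A) (m : Idx l) (n : Idx l') :
    ∑ k, (generator l m k : ℂ) * T k n = ∑ k, T m k * (generator l' k n : ℂ) := by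
  have h : (fun t : ℝ => ∑ k, (wignerSmallD l t m k : ℂ) * T k n) =
      fun t : ℝ => ∑ k, T m k * (wignerSmallD l' t k n : ℂ) := by
    ext t
    obtain ⟨A, hA⟩ := exists_coe_eq_rotY t
    have h := congrFun (congrFun (hT A) m) n
    rwa [wignerD_of_coe_eq_rotY l hA, wignerD_of_coe_eq_rotY l' hA] at h
  have h1 := HasDerivAt.fun_sum (u := Finset.univ) fun k _ =>
    (hasDerivAt_wignerSmallD_zero l m k).mul_const (T k n)
  have h2 := HasDerivAt.fun_sum (u := Finset.univ) fun k _ =>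
    (hasDerivAt_wignerSmallD_zero l' k n).const_mul (T m k)
  rw [h] at h1
  have h3 := h1.unique h2
  have e1 : ∑ k, 1 / 2 * (generator l m k : ℂ) * T k n =
      1 / 2 * ∑ k, (generator l m k : ℂ) * T k n := by
    rw [Finset.mul_sum]; exact Finset.sum_congr rfl fun k _ => by ring
  have e2 : ∑ k, T m k * (1 / 2 * (generator l' k n : ℂ)) =
      1 / 2 * ∑ k, T m k * (generator l' k n : ℂ) := by
    rw [Finset.mul_sum]; exact Finset.sum_congr rfl fun k _ => by ring
  rw [e1, e2] at h3
  exact mul_left_cancel₀ (by norm_num) h3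

theorem generator_of_add_one_eq {l : ℕ} {m n : Idx l} (h : m.1 + 1 = n.1) :
    generator l m n = √(((l : ℝ) - m.1) * ((l : ℝ) + m.1 + 1)) := by
  rw [generator_apply, ladder, Matrix.of_apply, Matrix.of_apply, if_pos h, if_neg (by omega),
    sub_zero]

theorem generator_ne_zero {l : ℕ} {m n : Idx l} (h : m.1 + 1 = n.1) :
    (generator l m n : ℂ) ≠ 0 := by
  rw [generator_of_add_one_eq h, Complex.ofReal_ne_zero]
  have h1 : (-(l : ℝ)) ≤ m.1 := by exact_mod_cast m.bounds.1
  have h2 : (m.1 : ℝ) + 1 ≤ l := by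
    have := n.bounds.2
    rw [← h] at this
    exact_mod_cast this
  exact (Real.sqrt_pos.2 (mul_pos (by linarith) (by linarith))).ne'

theorem generator_swap {l : ℕ} (m n : Idx l) : generator l n m = -generator l m n := by
  rw [generator_apply, generator_apply, neg_sub]

theorem generator_mul_intertwiner {l l' : ℕ} {T : Matrix (Idx l) (Idx l') ℂ}
    (hT : ∀ A, wignerD l A * T = T * wignerD l' A) {m n : Idx l} {m' n' : Idx l'}
    (hm : m.1 = m'.1) (hn : n.1 = n'.1) :
    (generator l m n : ℂ) * T n n' = T m m' * (generator l' m' n' : ℂ) := by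
  have h := generator_intertwiner hT m n'
  rwa [Finset.sum_eq_single n (fun k _ hk => ?_) (by simp),
    Finset.sum_eq_single m' (fun k _ hk => ?_) (by simp)] at h
  · rw [intertwiner_apply_eq_zero hT, zero_mul]
    exact fun e => hk (Subtype.ext (by omega))
  · rw [intertwiner_apply_eq_zero hT, mul_zero]
    exact fun e => hk (Subtype.ext (by omega))

/-- Only diagonal entries can survive. The weight `l' + 1` occurs in `D^l` but not in `D^{l'}`,
which kills the entry at weight `l'`; nonzero ladder coefficients then carry the vanishing down to
all lower weights. -/
theorem intertwiner_eq_zero {l l' : ℕ} (hl : l' < l) {T : Matrix (Idx l) (Idx l') ℂ}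
    (hT : ∀ A, wignerD l A * T = T * wignerD l' A) : T = 0 := by
  have key : ∀ (j : ℕ) (m : Idx l) (m' : Idx l'), m.1 = m'.1 → m'.1 = l' - j → T m m' = 0 := by
    intro j
    induction j with
    | zero =>
      intro m m' hm hj
      -- Row `n` of `T` is zero, so the generator relation at `(n, m')` reduces to a nonzero
      -- multiple of `T m m'`.
      let n : Idx l := ⟨l' + 1, Finset.mem_Icc.2 (by omega)⟩
      have hmn : m.1 + 1 = n.1 := by simp only [n]; omega
      have h := generator_intertwiner hT n m'
      rw [Finset.sum_eq_single m (fun k _ hk => ?_) (by simp), Finset.sum_eq_zero] at h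
      · rw [generator_swap m n] at h
        have := generator_ne_zero hmn
        simpa [this] using h
      · intro k _
        rw [intertwiner_apply_eq_zero hT, zero_mul]
        have := k.bounds
        simp only [n]; omega
      · rw [intertwiner_apply_eq_zero hT, mul_zero]
        exact fun e => hk (Subtype.ext (by omega))
    | succ j ih =>
      intro m m' hm hj
      have hb := m'.bounds
      let n : Idx l := ⟨m.1 + 1, Finset.mem_Icc.2 (by omega)⟩
      let n' : Idx l' := ⟨m'.1 + 1, Finset.mem_Icc.2 (by omega)⟩
      have h := generator_mul_intertwiner hT (m := m) (n := n) (m' := m') (n' := n') hm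
        (by simp only [n, n']; omega)
      rw [ih n n' (by simp only [n, n']; omega) (by simp only [n']; omega), mul_zero] at h
      have := generator_ne_zero (m := m') (n := n') rfl
      simpa [this] using h.symm
  ext m m'
  by_cases h : m.1 = m'.1
  · have := m'.bounds
    exact key (l' - m'.1).toNat m m' h (by omega)
  · exact intertwiner_apply_eq_zero hT h

/-- With the same generator on both sides, the ladder coefficients cancel and neighbouring diagonal
entries agree. -/
theorem intertwiner_eq_smul_one {l : ℕ} {T : Matrix (Idx l) (Idx l) ℂ}
    (hT : ∀ A, wignerD l A * T = T * wignerD l A) : ∃ c : ℂ, T = c • 1 := by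
  let top : Idx l := ⟨l, Finset.mem_Icc.2 (by omega)⟩
  have key : ∀ (j : ℕ) (m : Idx l), m.1 = l - j → T m m = T top top := by
    intro j
    induction j with
    | zero =>
      intro m hj
      rw [show m = top from Subtype.ext (by simp only [top]; omega)]
    | succ j ih =>
      intro m hj
      have hb := m.bounds
      let n : Idx l := ⟨m.1 + 1, Finset.mem_Icc.2 (by omega)⟩
      have h := generator_mul_intertwiner hT (m := m) (n := n) (m' := m) (n' := n) rfl rfl
      rw [mul_comm] at h
      rw [← mul_right_cancel₀ (generator_ne_zero (m := m) (n := n) rfl) h]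
      exact ih n (by simp only [n]; omega)
  refine ⟨T top top, ?_⟩
  ext m n
  by_cases h : m = n
  · subst h
    have := m.bounds
    rw [key (l - m.1).toNat m (by omega)]
    simp
  · rw [intertwiner_apply_eq_zero hT fun e => h (Subtype.ext e)]
    simp [Matrix.one_apply_ne h]

/-! ### Schur orthogonality -/

/-- The left action as a linear isometry. -/
def leftActionₗᵢ (A : SO3) : L2SO3 →ₗᵢ[ℂ] L2SO3 :=
  Lp.compMeasurePreservingₗᵢ ℂ (fun B : SO3 => A⁻¹ * B) (measurePreserving_mul_left haar A⁻¹)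

theorem inner_leftAction_leftAction (A : SO3) (x y : L2SO3) :
    inner ℂ (leftAction A x) (leftAction A y) = inner ℂ x y :=
  (leftActionₗᵢ A).inner_map_map x y

theorem leftAction_leftAction_inv (A : SO3) (y : L2SO3) :
    leftAction A (leftAction A⁻¹ y) = y := by
  rw [leftAction, leftAction, ← Lp.compMeasurePreserving_comp_apply]
  convert Lp.compMeasurePreserving_id_apply y using 3
  ext1 B
  simp

theorem coeFn_wignerL2 (l : ℕ) (m n : Idx l) :
    wignerL2 l m n =ᵐ[haar] fun A => wignerD l A m n := MemLp.coeFn_toLp _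

theorem leftAction_inv_wignerL2 (l : ℕ) (m n : Idx l) (A : SO3) :
    leftAction A⁻¹ (wignerL2 l m n) = ∑ k, wignerD l A m k • wignerL2 l k n := by
  refine Lp.ext ?_
  have h1 : leftAction A⁻¹ (wignerL2 l m n) =ᵐ[haar] fun B => wignerD l (A * B) m n := by
    have := (memLp_wignerD l m n).comp_measurePreserving (measurePreserving_mul_left haar A⁻¹⁻¹)
    refine (MemLp.coeFn_toLp this).trans (Filter.Eventually.of_forall fun B => ?_)
    simp
  have h2 : ∀ᵐ B ∂haar, ∀ k, (wignerD l A m k • wignerL2 l k n : L2SO3) B =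
      wignerD l A m k * wignerD l B k n := by
    refine (ae_all_iff).2 fun k => ?_
    filter_upwards [Lp.coeFn_smul (wignerD l A m k) (wignerL2 l k n), coeFn_wignerL2 l k n]
      with B hB hB'
    rw [hB, Pi.smul_apply, hB', smul_eq_mul]
  filter_upwards [h1, h2, Lp.coeFn_finsetSum Finset.univ
    fun k => (wignerD l A m k • wignerL2 l k n : L2SO3)] with B hB1 hB2 hB3
  rw [hB1, hB3, wignerD_mul, Matrix.mul_apply, Finset.sum_apply]
  exact Finset.sum_congr rfl fun k _ => (hB2 k).symm

/-- The Gram matrix of the `n`-th column of `D^l` and the `n'`-th column of `D^{l'}`. -/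
def columnGram (l l' : ℕ) (n : Idx l) (n' : Idx l') : Matrix (Idx l) (Idx l') ℂ :=
  Matrix.of fun m m' => inner ℂ (wignerL2 l' m' n') (wignerL2 l m n)

/-- Translation by `A⁻¹` preserves inner products and acts on each column by `D(A)`, so `G = D G
D'ᴴ`; unitarity moves `D'` to the other side. -/
theorem wignerD_mul_columnGram (l l' : ℕ) (n : Idx l) (n' : Idx l') (A : SO3) :
    wignerD l A * columnGram l l' n n' = columnGram l l' n n' * wignerD l' A := by
  have h : columnGram l l' n n' = wignerD l A * columnGram l l' n n' * (wignerD l' A)ᴴ := by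
    ext m m'
    rw [columnGram, Matrix.of_apply, ← inner_leftAction_leftAction A⁻¹, leftAction_inv_wignerL2,
      leftAction_inv_wignerL2, sum_inner, Matrix.mul_apply]
    refine Finset.sum_congr rfl fun k _ => ?_
    rw [inner_sum, Matrix.mul_apply, Finset.sum_mul]
    refine Finset.sum_congr rfl fun j _ => ?_
    rw [inner_smul_left, inner_smul_right, Matrix.conjTranspose_apply, Matrix.of_apply,
      RCLike.star_def]
    ring
  nth_rewrite 2 [h]
  rw [Matrix.mul_assoc, conjTranspose_mul_wignerD, Matrix.mul_one]

theorem inner_wignerL2_of_lt {l l' : ℕ} (hl : l' < l) (m n : Idx l) (m' n' : Idx l') :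
    inner ℂ (wignerL2 l' m' n') (wignerL2 l m n) = 0 :=
  congrFun (congrFun (intertwiner_eq_zero hl (wignerD_mul_columnGram l l' n n')) m) m'

theorem inner_wignerL2_of_ne {l l' : ℕ} (hl : l' ≠ l) (m n : Idx l) (m' n' : Idx l') :
    inner ℂ (wignerL2 l' m' n') (wignerL2 l m n) = 0 := by
  rcases lt_or_gt_of_ne hl with h | h
  · exact inner_wignerL2_of_lt h m n m' n'
  · rw [← inner_conj_symm, inner_wignerL2_of_lt h, map_zero]

/-- This is the trace of the Gram matrix: by unitarity the integrand is constant, and the total mass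
is one. -/
theorem sum_inner_wignerL2 (l : ℕ) (n n' : Idx l) :
    ∑ m, inner ℂ (wignerL2 l m n') (wignerL2 l m n) = if n' = n then 1 else 0 := by
  simp only [L2.inner_def]
  rw [← integral_finsetSum _ fun m _ => L2.integrable_inner _ _]
  have h : ∀ᵐ A ∂haar, ∑ m, inner ℂ (wignerL2 l m n' A) (wignerL2 l m n A) =
      if n' = n then (1 : ℂ) else 0 := by
    have h1 : ∀ᵐ A ∂haar, ∀ m, wignerL2 l m n' A = wignerD l A m n' :=
      (ae_all_iff).2 fun m => coeFn_wignerL2 l m n'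
    have h2 : ∀ᵐ A ∂haar, ∀ m, wignerL2 l m n A = wignerD l A m n :=
      (ae_all_iff).2 fun m => coeFn_wignerL2 l m n
    filter_upwards [h1, h2] with A hA1 hA2
    have hu := congrFun (congrFun (conjTranspose_mul_wignerD l A) n') n
    rw [Matrix.mul_apply, Matrix.one_apply] at hu
    rw [← hu]
    refine Finset.sum_congr rfl fun m _ => ?_
    rw [hA1, hA2, Matrix.conjTranspose_apply, RCLike.inner_apply, RCLike.star_def, mul_comm]
  rw [integral_congr_ae h]
  simp

theorem card_idx (l : ℕ) : Fintype.card (Idx l) = 2 * l + 1 := by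
  rw [Fintype.card_coe, Int.card_Icc]; omega

theorem inner_wignerL2 (l : ℕ) (m n m' n' : Idx l) :
    inner ℂ (wignerL2 l m' n') (wignerL2 l m n) =
      if m' = m ∧ n' = n then 1 / (2 * (l : ℂ) + 1) else 0 := by
  obtain ⟨c, hc⟩ := intertwiner_eq_smul_one (wignerD_mul_columnGram l l n n')
  have hG : ∀ m m', inner ℂ (wignerL2 l m' n') (wignerL2 l m n) = if m' = m then c else 0 := by
    intro m m'
    have := congrFun (congrFun hc m) m'
    rw [columnGram, Matrix.of_apply, Matrix.smul_apply, Matrix.one_apply, smul_eq_mul] at this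
    rw [this]
    simp [eq_comm]
  have hs := sum_inner_wignerL2 l n n'
  simp only [hG, if_true, Finset.sum_const, Finset.card_univ, card_idx, nsmul_eq_mul] at hs
  have hne : 2 * (l : ℂ) + 1 ≠ 0 := by exact_mod_cast Nat.succ_ne_zero (2 * l)
  push_cast at hs
  have hc' : c = if n' = n then 1 / (2 * (l : ℂ) + 1) else 0 := by
    rw [← mul_right_inj' hne, hs]
    split_ifs
    · rw [mul_one_div_cancel hne]
    · rw [mul_zero]
  rw [hG, hc', ite_and]

/-! ### Completeness: an algebra spanned by even powers of spinor forms -/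

/-- Polarization without finite differences: every linear functional on `R ⧸ W` turns `p` into a
scalar polynomial that vanishes everywhere. -/
theorem coeff_mem_of_forall_eval_mem {R : Type*} [CommRing R] [Algebra ℂ R] (W : Submodule ℂ R)
    (p : Polynomial R) (h : ∀ t : ℂ, p.eval (algebraMap ℂ R t) ∈ W) (i : ℕ) : p.coeff i ∈ W := by
  rw [← Submodule.Quotient.mk_eq_zero W, ← Module.forall_dual_apply_eq_zero_iff ℂ]
  intro φ
  let q : Polynomial ℂ := ∑ j ∈ Finset.range (p.natDegree + 1),
    Polynomial.monomial j (φ (W.mkQ (p.coeff j)))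
  have hq : q = 0 := by
    refine Polynomial.funext fun t => ?_
    have ht := (Submodule.Quotient.mk_eq_zero W).2 (h t)
    have : q.eval t = φ (W.mkQ (p.eval (algebraMap ℂ R t))) := by
      rw [p.eval_eq_sum_range, map_sum, map_sum, Polynomial.eval_finsetSum]
      refine Finset.sum_congr rfl fun j _ => ?_
      rw [Polynomial.eval_monomial, ← map_pow, mul_comm (p.coeff j), ← Algebra.smul_def, map_smul,
        map_smul, smul_eq_mul, mul_comm]
    rw [this, Submodule.mkQ_apply, ht, map_zero, Polynomial.eval_zero]
  by_cases hi : i ∈ Finset.range (p.natDegree + 1)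
  · have := congrArg (fun p => p.coeff i) hq
    simp only [q, Polynomial.finsetSum_coeff, Polynomial.coeff_monomial, Polynomial.coeff_zero,
      Finset.sum_ite_eq', if_pos hi] at this
    exact this
  · rw [Polynomial.coeff_eq_zero_of_natDegree_lt (by simpa using hi)]
    simp

theorem eval_derivative_mem_of_forall_eval_mem {R : Type*} [CommRing R] [Algebra ℂ R]
    (W : Submodule ℂ R) (p : Polynomial R) (h : ∀ t : ℂ, p.eval (algebraMap ℂ R t) ∈ W) :
    p.derivative.eval 0 ∈ W := by
  rw [← Polynomial.coeff_zero_eq_eval_zero, Polynomial.coeff_derivative]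
  simpa using coeff_mem_of_forall_eval_mem W p h 1

/-- The function `A ↦ v U w` on `SO(3)`, where `U` is the chosen lift of `A`. -/
def spinForm (v w : Fin 2 → ℂ) : SO3 → ℂ := fun A => (v ᵥ* spinLift A) ⬝ᵥ w

/-- The span of the `k`-th powers of the functions `A ↦ v U w`. -/
def formPowerSpan (k : ℕ) : Submodule ℂ (SO3 → ℂ) :=
  Submodule.span ℂ {f | ∃ v w, f = spinForm v w ^ k}

theorem spinForm_pow_mem (k : ℕ) (v w : Fin 2 → ℂ) : spinForm v w ^ k ∈ formPowerSpan k :=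
  Submodule.subset_span ⟨v, w, rfl⟩

theorem spinForm_add_smul_left (v v' w : Fin 2 → ℂ) (t : ℂ) :
    spinForm (v + t • v') w = spinForm v w + spinForm v' w * algebraMap ℂ (SO3 → ℂ) t := by
  ext A
  simp [spinForm, Matrix.add_vecMul, Matrix.smul_vecMul, add_dotProduct, mul_comm]

theorem spinForm_add_smul_right (v w w' : Fin 2 → ℂ) (t : ℂ) :
    spinForm v (w + t • w') = spinForm v w + spinForm v w' * algebraMap ℂ (SO3 → ℂ) t := by
  ext A
  simp [spinForm, dotProduct_add, mul_comm]

/-- Up to the factor `k + 1`, this is the derivative at `t = 0` of the power `k + 1` of `(v + t v')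
U w`. -/
theorem spinForm_pow_mul_left_mem (k : ℕ) (v v' w : Fin 2 → ℂ) :
    spinForm v w ^ k * spinForm v' w ∈ formPowerSpan (k + 1) := by
  have h := eval_derivative_mem_of_forall_eval_mem (formPowerSpan (k + 1))
    ((Polynomial.C (spinForm v w) + Polynomial.X * Polynomial.C (spinForm v' w)) ^ (k + 1))
    fun t => by
      simpa [spinForm_add_smul_left] using spinForm_pow_mem (k + 1) (v + t • v') w
  simp only [Polynomial.derivative_pow, Polynomial.derivative_add, Polynomial.derivative_mul,
    Polynomial.derivative_C, Polynomial.derivative_X, Polynomial.eval_mul, Polynomial.eval_pow,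
    Polynomial.eval_add, Polynomial.eval_C, Polynomial.eval_X, Nat.add_sub_cancel] at h
  have h2 := (formPowerSpan (k + 1)).smul_mem ((k + 1 : ℂ)⁻¹) h
  convert h2 using 1
  ext A
  have : (k + 1 : ℂ) ≠ 0 := by exact_mod_cast Nat.succ_ne_zero k
  simp
  field_simp

/-- The difference of the two products is the determinant of a product of three `2 × 2` matrices,
the middle one being `U` with `det U = 1`. -/
theorem spinForm_mul_spinForm (v v' w w' : Fin 2 → ℂ) :
    spinForm v' w * spinForm v w' = spinForm v w * spinForm v' w' -
      algebraMap ℂ (SO3 → ℂ) ((v 0 * v' 1 - v 1 * v' 0) * (w 0 * w' 1 - w 1 * w' 0)) := by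
  ext A
  have h := det_spinLift A
  rw [Matrix.det_fin_two] at h
  simp [spinForm, Matrix.vecMul, dotProduct, Fin.sum_univ_two]
  linear_combination ((v 0 * v' 1 - v 1 * v' 0) * (w 0 * w' 1 - w 1 * w' 0)) * -h

/-- A Clebsch–Gordan rule. Replacing `w` by `w + t w'` and differentiating also yields the mixed
product of `v' U w` and `v U w'`; exchanging it by `spinForm_mul_spinForm` gives `k + 2` copies of
the wanted term and an error of degree `k`. -/
theorem spinForm_pow_succ_mul_mem (k : ℕ) (v v' w w' : Fin 2 → ℂ) :
    spinForm v w ^ (k + 1) * spinForm v' w' ∈ formPowerSpan (k + 2) ⊔ formPowerSpan k := by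
  have h := eval_derivative_mem_of_forall_eval_mem (formPowerSpan (k + 2))
    ((Polynomial.C (spinForm v w) + Polynomial.X * Polynomial.C (spinForm v w')) ^ (k + 1) *
      (Polynomial.C (spinForm v' w) + Polynomial.X * Polynomial.C (spinForm v' w')))
    fun t => by
      simpa [spinForm_add_smul_right] using spinForm_pow_mul_left_mem (k + 1) v v' (w + t • w')
  simp only [Polynomial.derivative_pow, Polynomial.derivative_add, Polynomial.derivative_mul,
    Polynomial.derivative_C, Polynomial.derivative_X, Polynomial.eval_mul, Polynomial.eval_pow,
    Polynomial.eval_add, Polynomial.eval_C, Polynomial.eval_X, Nat.add_sub_cancel] at h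
  have h2 := Submodule.add_mem_sup ((formPowerSpan (k + 2)).smul_mem ((k + 2 : ℂ)⁻¹) h)
    ((formPowerSpan k).smul_mem ((k + 2 : ℂ)⁻¹ * (k + 1) *
      ((v 0 * v' 1 - v 1 * v' 0) * (w 0 * w' 1 - w 1 * w' 0))) (spinForm_pow_mem k v w))
  convert h2 using 1
  ext A
  have hm := congrFun (spinForm_mul_spinForm v v' w w') A
  have : (k + 2 : ℂ) ≠ 0 := by exact_mod_cast Nat.succ_ne_zero (k + 1)
  simp at hm
  simp
  field_simp
  linear_combination -(k + 1) * spinForm v w A ^ k * hm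

/-- The span of the even powers of the functions `A ↦ v U w`. -/
def evenFormSpan : Submodule ℂ (SO3 → ℂ) := ⨆ l, formPowerSpan (2 * l)

/-- The span of the odd powers of the functions `A ↦ v U w`. -/
def oddFormSpan : Submodule ℂ (SO3 → ℂ) := ⨆ l, formPowerSpan (2 * l + 1)

theorem formPowerSpan_le_even (l : ℕ) : formPowerSpan (2 * l) ≤ evenFormSpan :=
  le_iSup (fun l => formPowerSpan (2 * l)) l

theorem formPowerSpan_le_odd (l : ℕ) : formPowerSpan (2 * l + 1) ≤ oddFormSpan :=
  le_iSup (fun l => formPowerSpan (2 * l + 1)) l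

theorem iSup_formPowerSpan_mul_mem (a : ℕ → ℕ) (W : Submodule ℂ (SO3 → ℂ)) (v' w' : Fin 2 → ℂ)
    (h : ∀ l v w, spinForm v w ^ a l * spinForm v' w' ∈ W) {f : SO3 → ℂ}
    (hf : f ∈ ⨆ l, formPowerSpan (a l)) : f * spinForm v' w' ∈ W := by
  have : ⨆ l, formPowerSpan (a l) ≤ W.comap (LinearMap.mulRight ℂ (spinForm v' w')) := by
    refine iSup_le fun l => Submodule.span_le.2 ?_
    rintro _ ⟨v, w, rfl⟩
    exact h l v w
  exact this hf

theorem evenFormSpan_mul_mem (v' w' : Fin 2 → ℂ) {f : SO3 → ℂ} (hf : f ∈ evenFormSpan) :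
    f * spinForm v' w' ∈ oddFormSpan := by
  refine iSup_formPowerSpan_mul_mem (fun l => 2 * l) _ v' w' (fun l v w => ?_) hf
  cases l with
  -- Degree zero has no lower neighbour, so the product is already a first power.
  | zero =>
    have := formPowerSpan_le_odd 0 (spinForm_pow_mem _ v' w')
    simpa using this
  | succ l =>
    exact sup_le (formPowerSpan_le_odd (l + 1)) (formPowerSpan_le_odd l)
      (spinForm_pow_succ_mul_mem (2 * l + 1) v v' w w')

theorem oddFormSpan_mul_mem (v' w' : Fin 2 → ℂ) {f : SO3 → ℂ} (hf : f ∈ oddFormSpan) :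
    f * spinForm v' w' ∈ evenFormSpan := by
  refine iSup_formPowerSpan_mul_mem (fun l => 2 * l + 1) _ v' w' (fun l v w => ?_) hf
  exact sup_le (formPowerSpan_le_even (l + 1)) (formPowerSpan_le_even l)
    (spinForm_pow_succ_mul_mem (2 * l) v v' w w')

/-- The functions that multiply `evenFormSpan` into itself. -/
def evenMultipliers : Subalgebra ℂ (SO3 → ℂ) where
  carrier := {g | ∀ f ∈ evenFormSpan, f * g ∈ evenFormSpan}
  mul_mem' {a b} ha hb f hf := by
    rw [← mul_assoc]; exact hb _ (ha _ hf)
  add_mem' {a b} ha hb f hf := by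
    rw [mul_add]; exact add_mem (ha _ hf) (hb _ hf)
  algebraMap_mem' c f hf := by
    rw [mul_comm, ← Algebra.smul_def]; exact Submodule.smul_mem _ c hf

/-- Multipliers form an algebra by construction, so membership of polynomials in the span need only
be checked on generators. -/
theorem mem_evenFormSpan_of_mem_evenMultipliers {g : SO3 → ℂ} (hg : g ∈ evenMultipliers) :
    g ∈ evenFormSpan := by
  have h1 : (1 : SO3 → ℂ) ∈ evenFormSpan := by
    -- The zeroth power of any form, even of the zero form, is `1`.
    simpa using formPowerSpan_le_even 0 (spinForm_pow_mem _ 0 0)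
  simpa using hg 1 h1

theorem spinLift_mul_mem (i j i' j' : Fin 2) :
    (fun A => spinLift A i j * spinLift A i' j') ∈ evenMultipliers := by
  have h : ∀ i j, (fun A => spinLift A i j) = spinForm (Pi.single i 1) (Pi.single j 1) := by
    intro i j
    ext A
    simp [spinForm]
  intro f hf
  have := oddFormSpan_mul_mem (Pi.single i' 1) (Pi.single j' 1)
    (evenFormSpan_mul_mem (Pi.single i 1) (Pi.single j 1) hf)
  rwa [← h, ← h, mul_assoc] at this

/-- The entries of `A` are quadratic in the entries of its lift, and multiplying by two of those
goes from even to odd and back. -/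
theorem entry_mem_evenMultipliers (i j : Fin 3) :
    (fun A : SO3 => (A.1 i j : ℂ)) ∈ evenMultipliers := by
  have he : (fun A : SO3 => (A.1 i j : ℂ)) = fun A => spinAdjoint (spinLift A) i j := by
    ext A
    rw [spinAdjoint_spinLift]; rfl
  rw [he]
  have m := spinLift_mul_mem
  have sq : ∀ i j, (fun A => spinLift A i j ^ 2) ∈ evenMultipliers := fun i j => by
    simpa only [pow_two] using m i j i j
  have add : ∀ {f g : SO3 → ℂ}, f ∈ evenMultipliers → g ∈ evenMultipliers →
    (fun A => f A + g A) ∈ evenMultipliers := fun hf hg => add_mem hf hg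
  have sub : ∀ {f g : SO3 → ℂ}, f ∈ evenMultipliers → g ∈ evenMultipliers →
    (fun A => f A - g A) ∈ evenMultipliers := fun hf hg => sub_mem hf hg
  have neg : ∀ {f : SO3 → ℂ}, f ∈ evenMultipliers →
    (fun A => -f A) ∈ evenMultipliers := fun hf => neg_mem hf
  have const : ∀ (c : ℂ) {f : SO3 → ℂ}, f ∈ evenMultipliers →
    (fun A => c * f A) ∈ evenMultipliers := fun c _ hf => evenMultipliers.smul_mem hf c
  have half : ∀ {f : SO3 → ℂ}, f ∈ evenMultipliers →
      (fun A => f A / 2) ∈ evenMultipliers := fun {f} hf => by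
    simpa only [div_eq_inv_mul] using const 2⁻¹ hf
  fin_cases i <;> fin_cases j <;> simp only [spinAdjoint, Matrix.of_apply, Matrix.cons_val,
    Fin.mk_zero, Fin.mk_one, Fin.reduceFinMk]
  · exact half (sub (add (sub (sq _ _) (sq _ _)) (sq _ _)) (sq _ _))
  · exact const _ (half (sub (sub (add (sq _ _) (sq _ _)) (sq _ _)) (sq _ _)))
  · exact sub (m _ _ _ _) (m _ _ _ _)
  · exact const _ (half (sub (add (sub (sq _ _) (sq _ _)) (sq _ _)) (sq _ _)))
  · exact half (add (add (add (sq _ _) (sq _ _)) (sq _ _)) (sq _ _))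
  · exact const _ (neg (add (m _ _ _ _) (m _ _ _ _)))
  · exact sub (m _ _ _ _) (m _ _ _ _)
  · exact const _ (add (m _ _ _ _) (m _ _ _ _))
  · exact add (m _ _ _ _) (m _ _ _ _)

/-- This is the binomial theorem with index `l + n`; the normalization of the monomials supplies the
binomial coefficients. -/
theorem sum_spinMonomial_mul_spinMonomial (l : ℕ) (x w : Fin 2 → ℂ) :
    ∑ n, spinMonomial l x n * spinMonomial l w n = (x ⬝ᵥ w) ^ (2 * l) / (2 * l).factorial := by
  rw [dotProduct, Fin.sum_univ_two, add_pow, Finset.sum_div]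
  refine Finset.sum_bij' (fun n _ => (l + n.1).toNat)
    (fun i hi => (⟨(i : ℤ) - l, Finset.mem_Icc.2 (by have := Finset.mem_range.1 hi; omega)⟩ : Idx l))
    (fun n _ => ?_) (fun _ _ => Finset.mem_univ _) (fun n _ => ?_) (fun i _ => ?_) (fun n _ => ?_)
  · have := n.bounds
    exact Finset.mem_range.2 (by omega)
  · have := n.bounds
    exact Subtype.ext (by simp only; omega)
  · simp
  · have hb := n.bounds
    obtain ⟨q, hq⟩ : ∃ q, (l - n.1).toNat = q := ⟨_, rfl⟩
    obtain ⟨p, hp⟩ : ∃ p, (l + n.1).toNat = p := ⟨_, rfl⟩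
    have hpq : 2 * l = p + q := by omega
    have hs : ((√((p.factorial : ℝ) * (q.factorial : ℝ)) : ℝ) : ℂ) ^ 2 =
        p.factorial * q.factorial := by
      rw [← Complex.ofReal_pow, Real.sq_sqrt (by positivity)]
      push_cast; rfl
    have hc : (((p + q).choose p : ℕ) : ℂ) * (p.factorial * q.factorial) = (p + q).factorial := by
      rw [← mul_assoc, Nat.choose_symm_add]
      exact_mod_cast Nat.add_choose_mul_factorial_mul_factorial p q
    have n1 : (p.factorial : ℂ) ≠ 0 := by exact_mod_cast p.factorial_ne_zero
    have n2 : (q.factorial : ℂ) ≠ 0 := by exact_mod_cast q.factorial_ne_zero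
    have n3 : ((p + q).factorial : ℂ) ≠ 0 := by exact_mod_cast (p + q).factorial_ne_zero
    rw [spinMonomial, spinMonomial, hp, hq, hpq, Nat.add_sub_cancel_left, div_mul_div_comm,
      ← pow_two, hs, ← hc, mul_pow, mul_pow]
    have n4 : (((p + q).choose p : ℕ) : ℂ) ≠ 0 := fun h => n3 (by rw [← hc, h, zero_mul])
    field_simp

/-- The span of the coefficient functions of all Wigner D-matrices. -/
def wignerSpan : Submodule ℂ (SO3 → ℂ) :=
  Submodule.span ℂ {f | ∃ (l : ℕ) (m n : Idx l), f = fun A => wignerD l A m n}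

/-- Expanding `(v U w)^(2l)` in monomials of `v U` and of `w` leaves the entries of `D^l` with
coefficients independent of `A`. -/
theorem evenFormSpan_le_wignerSpan : evenFormSpan ≤ wignerSpan := by
  refine iSup_le fun l => Submodule.span_le.2 ?_
  rintro _ ⟨v, w, rfl⟩
  have h : spinForm v w ^ (2 * l) = ∑ n, ∑ m, (((2 * l).factorial : ℂ) * spinMonomial l v m *
      spinMonomial l w n) • fun A => wignerD l A m n := by
    ext A
    have h := sum_spinMonomial_mul_spinMonomial l (v ᵥ* spinLift A) w
    have hne : ((2 * l).factorial : ℂ) ≠ 0 := by exact_mod_cast (2 * l).factorial_ne_zero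
    rw [eq_div_iff hne] at h
    rw [Pi.pow_apply, spinForm, ← h, spinMonomial_vecMul_spinLift, Finset.sum_apply, Finset.sum_mul]
    refine Finset.sum_congr rfl fun n _ => ?_
    rw [Finset.sum_apply, Matrix.vecMul, dotProduct, Finset.sum_mul, Finset.sum_mul]
    refine Finset.sum_congr rfl fun m _ => ?_
    rw [Pi.smul_apply, smul_eq_mul]
    ring
  rw [h]
  exact Submodule.sum_mem _ fun n _ => Submodule.sum_mem _ fun m _ =>
    Submodule.smul_mem _ _ (Submodule.subset_span ⟨l, m, n, rfl⟩)

/-! ### Density by Stone–Weierstrass -/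

/-- The matrix entries as continuous functions on `SO(3)`. -/
def entryMap (i j : Fin 3) : C(SO3, ℂ) :=
  ⟨fun A => (A.1 i j : ℂ), Complex.continuous_ofReal.comp (continuous_subtype_val.matrix_elem i j)⟩

/-- The polynomial functions on `SO(3)`. -/
def entryPolynomials : StarSubalgebra ℂ C(SO3, ℂ) :=
  StarAlgebra.adjoin ℂ (Set.range fun p : Fin 3 × Fin 3 => entryMap p.1 p.2)

theorem entryPolynomials_closure : entryPolynomials.topologicalClosure = ⊤ := by
  refine ContinuousMap.starSubalgebra_topologicalClosure_eq_top_of_separatesPoints _ ?_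
  intro A B hAB
  have : ∃ i j, A.1 i j ≠ B.1 i j := by
    by_contra! h
    exact hAB (Subtype.ext (Matrix.ext h))
  obtain ⟨i, j, hij⟩ := this
  refine ⟨entryMap i j, ⟨entryMap i j, StarAlgebra.subset_adjoin ℂ _ ⟨(i, j), rfl⟩, rfl⟩, ?_⟩
  exact fun h => hij (Complex.ofReal_injective h)

theorem coe_mem_wignerSpan {f : C(SO3, ℂ)} (hf : f ∈ entryPolynomials) :
    (f : SO3 → ℂ) ∈ wignerSpan := by
  refine evenFormSpan_le_wignerSpan (mem_evenFormSpan_of_mem_evenMultipliers ?_)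
  have hle : entryPolynomials.toSubalgebra ≤
      evenMultipliers.comap (ContinuousMap.coeFnAlgHom ℂ) := by
    rw [entryPolynomials, StarAlgebra.adjoin_toSubalgebra]
    refine Algebra.adjoin_le ?_
    rintro g (⟨p, rfl⟩ | ⟨p, hp⟩)
    · exact entry_mem_evenMultipliers p.1 p.2
    -- The entries are real, so closing under conjugation adds no generators.
    · have : g = entryMap p.1 p.2 := by
        rw [← star_star g, ← hp]
        ext A
        exact Complex.conj_ofReal _
      rw [this]
      exact entry_mem_evenMultipliers p.1 p.2
  exact hle hf

theorem exists_toLp_mem_span {g : SO3 → ℂ} (hg : g ∈ wignerSpan) :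
    ∃ h : MemLp g 2 haar, h.toLp ∈ Submodule.span ℂ
      (Set.range fun i : (l : ℕ) × (Idx l × Idx l) => wignerL2 i.1 i.2.1 i.2.2) := by
  induction hg using Submodule.span_induction with
  | mem f hf =>
    obtain ⟨l, m, n, rfl⟩ := hf
    exact ⟨memLp_wignerD l m n, Submodule.subset_span ⟨⟨l, m, n⟩, rfl⟩⟩
  | zero => exact ⟨MemLp.zero, by rw [MemLp.toLp_zero]; exact Submodule.zero_mem _⟩
  | add f g _ _ hf hg =>
    obtain ⟨h1, h2⟩ := hf
    obtain ⟨h3, h4⟩ := hg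
    exact ⟨h1.add h3, by rw [h1.toLp_add h3]; exact Submodule.add_mem _ h2 h4⟩
  | smul c f _ hf =>
    obtain ⟨h1, h2⟩ := hf
    exact ⟨h1.const_smul c, by rw [h1.toLp_const_smul c]; exact Submodule.smul_mem _ c h2⟩

theorem span_wignerL2_closure : (Submodule.span ℂ (Set.range
    fun i : (l : ℕ) × (Idx l × Idx l) => wignerL2 i.1 i.2.1 i.2.2)).topologicalClosure = ⊤ := by
  have h1 : entryPolynomials.toSubalgebra.toSubmodule.topologicalClosure = ⊤ :=
    congrArg (fun S : StarSubalgebra ℂ C(SO3, ℂ) => S.toSubalgebra.toSubmodule)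
      entryPolynomials_closure
  have h2 := (ContinuousMap.toLp_denseRange (p := 2) ℂ haar ℂ
    (by norm_num)).topologicalClosure_map_submodule h1
  refine top_le_iff.1 (h2 ▸ Submodule.topologicalClosure_mono ?_)
  rintro _ ⟨f, hf, rfl⟩
  obtain ⟨h, hh⟩ := exists_toLp_mem_span (coe_mem_wignerSpan hf)
  exact hh

/-! ### Hilbert basis and Fourier coefficients -/

/-- The index set of the coefficient functions `D^l_{m,n}`. -/
abbrev CoeffIdx : Type := (l : ℕ) × (Idx l × Idx l)

/-- The coefficient functions `D^l_{m,n}` as one family. -/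
def wignerFamily (i : CoeffIdx) : L2SO3 := wignerL2 i.1 i.2.1 i.2.2

theorem two_mul_add_one_ne_zero (l : ℕ) : 2 * (l : ℂ) + 1 ≠ 0 := by
  exact_mod_cast Nat.succ_ne_zero (2 * l)

theorem inner_wignerFamily_self (i : CoeffIdx) :
    inner ℂ (wignerFamily i) (wignerFamily i) = 1 / (2 * (i.1 : ℂ) + 1) := by
  rw [wignerFamily, inner_wignerL2, if_pos ⟨rfl, rfl⟩]

theorem inner_wignerFamily_of_ne {i j : CoeffIdx} (h : i ≠ j) :
    inner ℂ (wignerFamily i) (wignerFamily j) = 0 := by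
  obtain ⟨l, m, n⟩ := i
  obtain ⟨l', m', n'⟩ := j
  by_cases hl : l = l'
  · subst hl
    rw [wignerFamily, wignerFamily, inner_wignerL2, if_neg]
    rintro ⟨h1, h2⟩
    simp only at h1 h2
    exact h (by rw [h1, h2])
  · exact inner_wignerL2_of_ne hl _ _ _ _

theorem orthonormal_wignerFamily :
    Orthonormal ℂ fun i : CoeffIdx => ((√(2 * i.1 + 1) : ℝ) : ℂ) • wignerFamily i := by
  classical
  rw [orthonormal_iff_ite]
  intro i j
  rw [inner_smul_left, inner_smul_right]
  split_ifs with h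
  · subst h
    rw [inner_wignerFamily_self, Complex.conj_ofReal, ← mul_assoc, ← Complex.ofReal_mul,
      Real.mul_self_sqrt (by positivity)]
    push_cast
    exact mul_one_div_cancel (two_mul_add_one_ne_zero _)
  · rw [inner_wignerFamily_of_ne h, mul_zero, mul_zero]

theorem span_wignerFamily_closure :
    ⊤ ≤ (Submodule.span ℂ (Set.range
      fun i : CoeffIdx => ((√(2 * i.1 + 1) : ℝ) : ℂ) • wignerFamily i)).topologicalClosure := by
  rw [← span_wignerL2_closure]
  refine Submodule.topologicalClosure_mono (Submodule.span_le.2 ?_)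
  rintro _ ⟨i, rfl⟩
  have hne : ((√(2 * i.1 + 1) : ℝ) : ℂ) ≠ 0 := by
    rw [Complex.ofReal_ne_zero]; positivity
  have := Submodule.smul_mem (Submodule.span ℂ (Set.range
    fun i : CoeffIdx => ((√(2 * i.1 + 1) : ℝ) : ℂ) • wignerFamily i))
    ((√(2 * i.1 + 1) : ℝ) : ℂ)⁻¹ (Submodule.subset_span ⟨i, rfl⟩)
  rwa [inv_smul_smul₀ hne] at this

/-- The normalized coefficient functions `√(2l+1) D^l_{m,n}` form a Hilbert basis. -/
def wignerBasis : HilbertBasis CoeffIdx ℂ L2SO3 :=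
  HilbertBasis.mk orthonormal_wignerFamily span_wignerFamily_closure

theorem exists_hasFourierCoeffs (x : L2SO3) : ∃ c, HasFourierCoeffs x c := by
  refine ⟨fun l m n => wignerBasis.repr x ⟨l, -m, -n⟩ * ((√(2 * l + 1) : ℝ) : ℂ), ?_⟩
  have h := wignerBasis.hasSum_repr x
  refine h.congr_fun fun i => ?_
  simp only [neg_neg]
  rw [mul_smul, wignerBasis, HilbertBasis.coe_mk]
  rfl

/-- Orthogonality leaves one term of the series, with squared norm `1 / (2l+1)`; the sign changes
come from the indexing convention. -/
theorem HasFourierCoeffs.inner_wignerL2 {x : L2SO3} {c : CoeffFamily} (h : HasFourierCoeffs x c)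
    (l : ℕ) (m n : Idx l) :
    inner ℂ (wignerL2 l m n) x = c l (-m) (-n) / (2 * (l : ℂ) + 1) := by
  have h1 := h.mapL (innerSL ℂ (wignerL2 l m n))
  have h2 := hasSum_single (f := fun i : CoeffIdx => innerSL ℂ (wignerL2 l m n)
    (c i.1 (-i.2.1) (-i.2.2) • wignerL2 i.1 i.2.1 i.2.2)) ⟨l, m, n⟩ fun i hi => by
      rw [map_smul, innerSL_apply_apply]
      have := inner_wignerFamily_of_ne hi.symm
      rw [wignerFamily, wignerFamily] at this
      rw [this, smul_zero]
  have h3 := h1.unique h2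
  rw [innerSL_apply_apply, map_smul, innerSL_apply_apply] at h3
  rw [h3, SO3Fourier.inner_wignerL2, if_pos ⟨rfl, rfl⟩, smul_eq_mul, mul_one_div]

theorem HasFourierCoeffs.unique {x : L2SO3} {c d : CoeffFamily} (hc : HasFourierCoeffs x c)
    (hd : HasFourierCoeffs x d) : c = d := by
  ext l m n
  have h := (hc.inner_wignerL2 l (-m) (-n)).symm.trans (hd.inner_wignerL2 l (-m) (-n))
  rwa [div_left_inj' (two_mul_add_one_ne_zero l), neg_neg, neg_neg] at h

theorem hasFourierCoeffs_of_inner {x : L2SO3} {c : CoeffFamily}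
    (h : ∀ l m n, inner ℂ (wignerL2 l m n) x = c l (-m) (-n) / (2 * (l : ℂ) + 1)) :
    HasFourierCoeffs x c := by
  obtain ⟨d, hd⟩ := exists_hasFourierCoeffs x
  have : d = c := by
    ext l m n
    have h := (hd.inner_wignerL2 l (-m) (-n)).symm.trans (h l (-m) (-n))
    rwa [div_left_inj' (two_mul_add_one_ne_zero l), neg_neg, neg_neg] at h
  rwa [← this]

/-! ### The covariance operator and its coefficients -/

theorem continuous_leftAction (ψ : L2SO3) : Continuous fun A => leftAction A ψ := by
  let g : SO3 → C(SO3, SO3) := fun A => ⟨fun B => A⁻¹ * B, by fun_prop⟩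
  have hg : Continuous g :=
    ContinuousMap.continuous_of_continuous_uncurry _ (by
      show Continuous fun p : SO3 × SO3 => p.1⁻¹ * p.2
      fun_prop)
  exact (continuous_const (y := ψ)).compMeasurePreservingLp hg
    (fun A => measurePreserving_mul_left haar A⁻¹) (by norm_num)

theorem continuous_leftCovariance (x ψ : L2SO3) : Continuous (leftCovariance x ψ) :=
  (continuous_leftAction ψ).inner continuous_const

theorem norm_leftCovariance_le (x ψ : L2SO3) (A : SO3) : ‖leftCovariance x ψ A‖ ≤ ‖ψ‖ * ‖x‖ := by
  have h : ‖leftAction A ψ‖ = ‖ψ‖ := (leftActionₗᵢ A).norm_map ψ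
  rw [← h]
  exact norm_inner_le_norm _ _

theorem memLp_leftCovariance (x ψ : L2SO3) : MemLp (leftCovariance x ψ) 2 haar :=
  MemLp.of_bound (continuous_leftCovariance x ψ).aestronglyMeasurable _
    (Filter.Eventually.of_forall (norm_leftCovariance_le x ψ))

theorem leftCovariance_add (x y ψ : L2SO3) :
    leftCovariance (x + y) ψ = leftCovariance x ψ + leftCovariance y ψ :=
  funext fun _ => inner_add_right _ _ _

theorem leftCovariance_smul (c : ℂ) (x ψ : L2SO3) :
    leftCovariance (c • x) ψ = c • leftCovariance x ψ :=
  funext fun _ => inner_smul_right _ _ _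

/-- The left covariance with `ψ` as a continuous linear map of `L²(SO(3), ℂ)`. -/
def covarianceMap (ψ : L2SO3) : L2SO3 →L[ℂ] L2SO3 :=
  LinearMap.mkContinuous
    { toFun := fun x => (memLp_leftCovariance x ψ).toLp
      map_add' := fun x y => by
        rw [← MemLp.toLp_add]
        exact MemLp.toLp_congr _ _ (by rw [leftCovariance_add])
      map_smul' := fun c x => by
        rw [RingHom.id_apply, ← MemLp.toLp_const_smul]
        exact MemLp.toLp_congr _ _ (by rw [leftCovariance_smul]) }
    -- The uniform Cauchy–Schwarz bound is also an `L²` bound, since the Haar measure has mass one.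
    ‖ψ‖ fun x => by
      have h := Lp.norm_le_of_ae_bound (f := (memLp_leftCovariance x ψ).toLp) (C := ‖ψ‖ * ‖x‖)
        (by positivity) (by
          filter_upwards [MemLp.coeFn_toLp (memLp_leftCovariance x ψ)] with A hA
          rw [hA]
          exact norm_leftCovariance_le x ψ A)
      simpa [measureUnivNNReal] using h

theorem covarianceMap_apply (ψ x : L2SO3) :
    covarianceMap ψ x = (memLp_leftCovariance x ψ).toLp := rfl

/-- Moving the translation from `ψ` to `D^l_{m,n}` expands the latter by multiplicativity, which
separates `A` from `ψ`. -/
theorem leftCovariance_wignerL2 (ψ : L2SO3) (l : ℕ) (m n : Idx l) (A : SO3) :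
    leftCovariance (wignerL2 l m n) ψ A =
      ∑ s, inner ℂ ψ (wignerL2 l s n) * wignerD l A m s := by
  have h := inner_leftAction_leftAction A ψ (leftAction A⁻¹ (wignerL2 l m n))
  rw [leftAction_leftAction_inv] at h
  rw [leftCovariance, h, leftAction_inv_wignerL2, inner_sum]
  refine Finset.sum_congr rfl fun s _ => ?_
  rw [inner_smul_right, mul_comm]

theorem covarianceMap_wignerL2 (ψ : L2SO3) (l : ℕ) (m n : Idx l) :
    covarianceMap ψ (wignerL2 l m n) =
      ∑ s, inner ℂ ψ (wignerL2 l s n) • wignerL2 l m s := by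
  rw [covarianceMap_apply]
  refine Lp.ext ?_
  have h2 : ∀ᵐ A ∂haar, ∀ s, (inner ℂ ψ (wignerL2 l s n) • wignerL2 l m s : L2SO3) A =
      inner ℂ ψ (wignerL2 l s n) * wignerD l A m s := by
    refine (ae_all_iff).2 fun s => ?_
    filter_upwards [Lp.coeFn_smul (inner ℂ ψ (wignerL2 l s n)) (wignerL2 l m s),
      coeFn_wignerL2 l m s] with A hA hA'
    rw [hA, Pi.smul_apply, hA', smul_eq_mul]
  filter_upwards [MemLp.coeFn_toLp (memLp_leftCovariance (wignerL2 l m n) ψ), h2,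
    Lp.coeFn_finsetSum Finset.univ
      fun s => (inner ℂ ψ (wignerL2 l s n) • wignerL2 l m s : L2SO3)] with A h1 h2 h3
  rw [h1, h3, leftCovariance_wignerL2, Finset.sum_apply]
  exact Finset.sum_congr rfl fun s _ => (h2 s).symm

theorem inner_covarianceMap_wignerL2 (ψ : L2SO3) (l : ℕ) (p q m n : Idx l) :
    inner ℂ (wignerL2 l p q) (covarianceMap ψ (wignerL2 l m n)) =
      if p = m then inner ℂ ψ (wignerL2 l q n) / (2 * (l : ℂ) + 1) else 0 := by
  rw [covarianceMap_wignerL2, inner_sum]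
  simp only [inner_smul_right, inner_wignerL2]
  split_ifs with h
  · rw [Finset.sum_eq_single q (fun s _ hs => ?_) (by simp), if_pos ⟨h, rfl⟩, mul_one_div]
    rw [if_neg fun e => hs e.2.symm, mul_zero]
  · exact Finset.sum_eq_zero fun s _ => by rw [if_neg fun e => h e.1, mul_zero]

theorem inner_covarianceMap_wignerL2_of_ne (ψ : L2SO3) {l l' : ℕ} (hl : l ≠ l') (p q : Idx l)
    (m n : Idx l') : inner ℂ (wignerL2 l p q) (covarianceMap ψ (wignerL2 l' m n)) = 0 := by
  rw [covarianceMap_wignerL2, inner_sum]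
  exact Finset.sum_eq_zero fun s _ => by
    rw [inner_smul_right, inner_wignerL2_of_ne hl, mul_zero]

theorem inner_covarianceMap {x ψ : L2SO3} {c : CoeffFamily} (hx : HasFourierCoeffs x c) (l : ℕ)
    (p q : Idx l) : inner ℂ (wignerL2 l p q) (covarianceMap ψ x) =
      ∑ n, c l (-p) (-n) * (inner ℂ ψ (wignerL2 l q n) / (2 * (l : ℂ) + 1)) := by
  have h1 := (hx.mapL (covarianceMap ψ)).mapL (innerSL ℂ (wignerL2 l p q))
  let g : Idx l → CoeffIdx := fun n => ⟨l, p, n⟩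
  have hg : Function.Injective g := fun n n' h => by simpa [g] using h
  -- Only the indices with degree `l` and first index `p` contribute.
  rw [← hg.hasSum_iff] at h1
  · refine h1.unique ?_
    convert hasSum_fintype _ using 1
    refine Finset.sum_congr rfl fun n _ => ?_
    simp only [Function.comp_apply, g, map_smul, innerSL_apply_apply]
    rw [inner_covarianceMap_wignerL2, if_pos rfl, smul_eq_mul]
  · rintro ⟨l', m, n⟩ hi
    simp only [map_smul, innerSL_apply_apply]
    by_cases hl : l = l'
    · subst hl
      rw [inner_covarianceMap_wignerL2, if_neg, smul_zero]
      rintro rfl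
      exact hi ⟨n, rfl⟩
    · rw [inner_covarianceMap_wignerL2_of_ne ψ hl, smul_zero]

theorem hasFourierCoeffs_leftCovariance {x ψ : L2SO3} {c d : CoeffFamily}
    (hx : HasFourierCoeffs x c) (hψ : HasFourierCoeffs ψ d) :
    HasFourierCoeffs (memLp_leftCovariance x ψ).toLp (fun l m n => 1 / (2 * (l : ℂ) + 1) *
      ∑ s : Idx l, c l m s * (starRingEnd ℂ) (d l n s)) := by
  refine hasFourierCoeffs_of_inner fun l p q => ?_
  -- The substitution `s = -n` absorbs the signs. One factor `1 / (2l+1)` stems from the inner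
  -- product with `ψ`, the other from the passage from inner products to coefficients.
  rw [← covarianceMap_apply, inner_covarianceMap hx,
    ← Equiv.sum_comp (Equiv.neg (Idx l)) fun s => c l (-p) s * (starRingEnd ℂ) (d l (-q) s),
    Finset.mul_sum, Finset.sum_div]
  refine Finset.sum_congr rfl fun n _ => ?_
  rw [← inner_conj_symm ψ, hψ.inner_wignerL2, map_div₀, Equiv.neg_apply]
  simp only [map_add, map_mul, map_one, Complex.conj_natCast, Complex.conj_ofNat]
  ring

end SO3Fourier

end

open SO3Fourier MeasureTheory in
theorem mainTheorem2 :
    (∀ x : L2SO3, ∃! c : CoeffFamily, HasFourierCoeffs x c) ∧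
      ∀ (x ψ : L2SO3) (xhat ψhat : CoeffFamily),
        HasFourierCoeffs x xhat → HasFourierCoeffs ψ ψhat →
          ∃ h : MemLp (leftCovariance x ψ) 2 haar,
            HasFourierCoeffs h.toLp
              (fun l m n => 1 / (2 * (l : ℂ) + 1) *
                ∑ s : Idx l, xhat l m s * (starRingEnd ℂ) (ψhat l n s)) := by
  refine ⟨fun x => ?_, fun x ψ xhat ψhat hx hψ =>
    ⟨memLp_leftCovariance x ψ, hasFourierCoeffs_leftCovariance hx hψ⟩⟩
  obtain ⟨c, hc⟩ := exists_hasFourierCoeffs x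
  exact ⟨c, hc, fun d hd => hd.unique hc⟩
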